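/- **Setting.** Let $\Lambda$ be the Grassmann algebra over $\mathbb K\in\{\mathbb R,\mathbb C\}$ on anticommuting generators (formal expansions in the monomials, with coefficientwise convergence). There are infinitely many generators if fermionic variables are present; any number of generators is allowed, including none, if all variables are bosonic. Let $q^A$, $1\le A\le\mathcal N$, be variables of parity $\#_A\in\mathbb Z_2$, with values in the even ($\#_A=0$) or odd ($\#_A=1$) part of $\Lambda$; time $t$ is real. $\partial/\partial z$ denotes left derivatives, so that $\delta F=\delta t\,\partial_tF+\delta z^M\,\partial F/\partial z^M$. All given functions are $\Lambda$-valued, supersmooth and of definite parity on open sets; summation over repeated indices is understood. *Lagrangian and primary constraints.* Let $L(q,\dot q,t)$ be an even Lagrangian on an open set $U$. Suppose that the relations $p_A=\partial L/\partial\dot q^A$ have been solved in the form $\dot q^{\hat a}=h^{\hat a}(q,p_a,\dot q^{\hat m},t)$, $p_m=f_m(q,p_a,t)$, where the momenta are split as $(p_a,p_m)$ and the velocities as $(\dot q^{\hat a},\dot q^{\hat m})$. That is, $(q,\dot q,t)\leftrightarrow(q,p_a,\dot q^{\hat m},t)$ is a one-to-one correspondence from $U$ onto an open set, with $h^{\hat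 a},f_m$ supersmooth, and for given $(q,p_a,t)$ the range of the $\dot q^{\hat m}$ is connected. Put $\phi_m=p_m-f_m(q,p_a,t)$, let $V=\{\phi_m=0\ \forall m\}$ be the primary constraint surface, and write $F\simeq G$ if $F=G$ on $V$. The canonical Hamiltonian is $H(q,p_a,t)=\dot q^Ap_A-L$, and $$\widetilde v^A(q,p_a,\dot q^m,t)=(-1)^{\#_A}\frac{\partial H}{\partial p_A}+(-1)^{\#_A(1+\#_m)}\dot q^m\frac{\partial\phi_m}{\partial p_A}$$ expresses the velocities through $(q,p_a,\dot q^m,t)$. *Symmetry.* Let $\delta q^A(q,\dot q,t)$ (of parity $\#_A$) and $\delta K(q,\dot q,t)$ (even) satisfy $\delta L=\frac{d}{dt}\delta K$ identically in $(q,\dot q,\ddot q,t)$, where $\delta\dot q^A=\frac{d}{dt}\delta q^A$. Put $$\delta p_A=\frac{\partial\,\delta K}{\partial q^A}-\frac{\partial\,\delta q^B}{\partial q^A}\frac{\partial L}{\partial\dot q^B}.$$ *Phase space functions.* Let $u^m(p,q,t)$ be any supersmooth functions of parity $\#_m$ on an open set $Y$ of the full phase space (with time) such that at each point of $Y$ the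 values $(q,p_a,\dot q^m=(-1)^{\#_m}u^m,t)$ come from a velocity: there is $\dot q$ with $(q,\dot q,t)\in U$, these $\dot q^m$, and $p_a=\partial L/\partial\dot q^a$. This includes in particular the general solution $u^m=U^m(p,q,t)+V^m{}_i(p,q,t)\,v^i(t)$ of the consistency conditions for the constraints, and also constant $u^m$ (independent $\dot q^m$). Let $\Delta q^A$, $\Delta p_A$ and $\widetilde{\delta K}$ be $\delta q^A$, $\delta p_A$ and $\delta K$ evaluated at $\dot q=\widetilde v(q,p_a,\dot q^m=(-1)^{\#_m}u^m,t)$, and define on $Y$ $$Q_T=\Delta q^Ap_A-\widetilde{\delta K},\qquad H_T=H+\phi_mu^m,$$ $$[F,G\}=(-1)^{\#_A\#_F}\frac{\partial F}{\partial q^A}\frac{\partial G}{\partial p_A}-(-1)^{\#_A(\#_F+1)}\frac{\partial F}{\partial p_A}\frac{\partial G}{\partial q^A}.$$ **Theorem.** $Q_T$ and $H_T$ are superdifferentiable on $Y$, and, without use of the equations of motion, on the primary constraint surface in $Y$: 1. $\displaystyle [Q_T,H_T\}+\frac{\partial Q_T}{\partial t}\simeq0$ (the total Noether charge is conserved); 2.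 $[Q_T,q^A\}\simeq-\Delta q^A$ and $[Q_T,p_A\}\simeq-\Delta p_A$ for all $A$ (it generates the symmetry transformations). Here $\delta p_A$ is the variation of the momentum up to the Euler–Lagrange equations: for all $(q,\dot q,t)\in U$ and all accelerations, $$\delta p_A=\delta\Big(\frac{\partial L}{\partial\dot q^A}\Big)-\frac{\partial\,\delta q^B}{\partial\dot q^A}\Big(\frac{d}{dt}\frac{\partial L}{\partial\dot q^B}-\frac{\partial L}{\partial q^B}\Big).$$ -/

import Mathlib

open Set Filter Topology

namespace SuperMech

/-! ### The Grassmann algebra -/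

/-- The Grassmann algebra over `𝕜` on anticommuting generators `ζ i`, `i : γ`.  An element is its
family of coefficients `x K` with respect to the monomials `ζ K` (`K` a finite set of generators,
multiplied in increasing order).  When `γ` is infinite, infinite formal expansions are allowed.
When `γ` is empty this is just `𝕜`. -/
def Grassmann (𝕜 γ : Type*) : Type _ := Finset γ → 𝕜

section Algebra

variable {𝕜 γ : Type*}

instance [CommRing 𝕜] : AddCommGroup (Grassmann 𝕜 γ) := inferInstanceAs (AddCommGroup (_ → 𝕜))

theorem add_coeff [CommRing 𝕜] (x y : Grassmann 𝕜 γ) (K : Finset γ) : (x + y) K = x K + y K := rfl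

theorem zero_coeff [CommRing 𝕜] (K : Finset γ) : (0 : Grassmann 𝕜 γ) K = 0 := rfl

/-- Convergence is convergence of each coefficient. -/
instance [TopologicalSpace 𝕜] : TopologicalSpace (Grassmann 𝕜 γ) :=
  inferInstanceAs (TopologicalSpace (_ → 𝕜))

noncomputable instance [RCLike 𝕜] : Module ℝ (Grassmann 𝕜 γ) := inferInstanceAs (Module ℝ (_ → 𝕜))

variable [LinearOrder γ]

/-- The number of transpositions needed to sort the product `ζ I * ζ J`. -/
def crossings (I J : Finset γ) : ℕ := ((I ×ˢ J).filter fun p => p.2 < p.1).card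

theorem crossings_union_left {I I' : Finset γ} (h : Disjoint I I') (J : Finset γ) :
    crossings (I ∪ I') J = crossings I J + crossings I' J := by
  unfold crossings
  rw [Finset.union_product, Finset.filter_union, Finset.card_union_of_disjoint]
  refine Finset.disjoint_filter_filter ?_
  rw [Finset.disjoint_left] at h ⊢
  rintro ⟨a, b⟩ h1 h2
  exact h (Finset.mem_product.1 h1).1 (Finset.mem_product.1 h2).1

theorem crossings_union_right {J J' : Finset γ} (h : Disjoint J J') (I : Finset γ) :
    crossings I (J ∪ J') = crossings I J + crossings I J' := by
  unfold crossings
  rw [Finset.product_union, Finset.filter_union, Finset.card_union_of_disjoint]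
  refine Finset.disjoint_filter_filter ?_
  rw [Finset.disjoint_left] at h ⊢
  rintro ⟨a, b⟩ h1 h2
  exact h (Finset.mem_product.1 h1).2 (Finset.mem_product.1 h2).2

variable [CommRing 𝕜]

/-- `ζ I * ζ J = ± ζ (I ∪ J)` for disjoint `I`, `J`, and `0` otherwise; each coefficient of a
product is a finite sum. -/
instance : Mul (Grassmann 𝕜 γ) :=
  ⟨fun x y K => ∑ I ∈ K.powerset, (-1) ^ crossings I (K \ I) * (x I * y (K \ I))⟩

instance : One (Grassmann 𝕜 γ) := ⟨fun K => if K = ∅ then 1 else 0⟩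

theorem mul_coeff (x y : Grassmann 𝕜 γ) (K : Finset γ) :
    (x * y) K = ∑ I ∈ K.powerset, (-1) ^ crossings I (K \ I) * (x I * y (K \ I)) := rfl

theorem one_coeff (K : Finset γ) : (1 : Grassmann 𝕜 γ) K = if K = ∅ then 1 else 0 := rfl

protected theorem mul_assoc (x y z : Grassmann 𝕜 γ) : x * y * z = x * (y * z) := by
  funext K
  simp only [mul_coeff, Finset.mul_sum, Finset.sum_mul]
  rw [Finset.sum_sigma', Finset.sum_sigma']
  refine Finset.sum_bij'
    (fun (p : (_ : Finset γ) × Finset γ) _ => (⟨p.2, p.1 \ p.2⟩ : (_ : Finset γ) × Finset γ))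
    (fun (p : (_ : Finset γ) × Finset γ) _ => (⟨p.1 ∪ p.2, p.1⟩ : (_ : Finset γ) × Finset γ))
    ?_ ?_ ?_ ?_ ?_
  · rintro ⟨I, J⟩ h
    simp only [Finset.mem_sigma, Finset.mem_powerset] at h ⊢
    exact ⟨h.2.trans h.1, Finset.sdiff_subset_sdiff h.1 le_rfl⟩
  · rintro ⟨J, M⟩ h
    simp only [Finset.mem_sigma, Finset.mem_powerset] at h ⊢
    exact ⟨Finset.union_subset h.1 (h.2.trans Finset.sdiff_subset), Finset.subset_union_left⟩
  · rintro ⟨I, J⟩ h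
    simp only [Finset.mem_sigma, Finset.mem_powerset] at h ⊢
    simp [Finset.union_sdiff_of_subset h.2]
  · rintro ⟨J, M⟩ h
    simp only [Finset.mem_sigma, Finset.mem_powerset] at h ⊢
    have : (J ∪ M) \ J = M := by
      rw [Finset.union_sdiff_left]
      exact Finset.sdiff_eq_self_of_disjoint (Finset.disjoint_of_subset_left h.2 Finset.sdiff_disjoint)
    simp [this]
  · rintro ⟨I, J⟩ h
    simp only [Finset.mem_sigma, Finset.mem_powerset] at h ⊢
    obtain ⟨hI, hJ⟩ := h
    have e1 : (K \ J) \ (I \ J) = K \ I := by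
      ext a; simp only [Finset.mem_sdiff]
      constructor
      · rintro ⟨⟨h1, h2⟩, h3⟩; exact ⟨h1, fun h => h3 ⟨h, h2⟩⟩
      · rintro ⟨h1, h2⟩; exact ⟨⟨h1, fun h => h2 (hJ h)⟩, fun h => h2 h.1⟩
    have e2 : K \ J = (I \ J) ∪ (K \ I) := by
      ext a; simp only [Finset.mem_sdiff, Finset.mem_union]
      constructor
      · rintro ⟨h1, h2⟩
        by_cases h : a ∈ I
        · exact Or.inl ⟨h, h2⟩
        · exact Or.inr ⟨h1, h⟩
      · rintro (⟨h1, h2⟩ | ⟨h1, h2⟩)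
        · exact ⟨hI h1, h2⟩
        · exact ⟨h1, fun h => h2 (hJ h)⟩
    have d1 : Disjoint (I \ J) (K \ I) :=
      Finset.disjoint_of_subset_left Finset.sdiff_subset
        (Finset.disjoint_sdiff : Disjoint I (K \ I))
    have c1 : crossings I (K \ I) = crossings J (K \ I) + crossings (I \ J) (K \ I) := by
      have := crossings_union_left (Finset.disjoint_sdiff : Disjoint J (I \ J)) (K \ I)
      rwa [Finset.union_sdiff_of_subset hJ] at this
    have c2 : crossings J (K \ J) = crossings J (I \ J) + crossings J (K \ I) := by
      rw [e2, crossings_union_right d1]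
    rw [e1, c1, c2, pow_add, pow_add]
    ring

instance : Ring (Grassmann 𝕜 γ) :=
  { (inferInstance : AddCommGroup (Grassmann 𝕜 γ)),
    (inferInstance : Mul (Grassmann 𝕜 γ)),
    (inferInstance : One (Grassmann 𝕜 γ)) with
    left_distrib := fun x y z => by
      funext K
      simp only [mul_coeff, add_coeff, mul_add, Finset.sum_add_distrib]
    right_distrib := fun x y z => by
      funext K
      simp only [mul_coeff, add_coeff, add_mul, mul_add, Finset.sum_add_distrib]
    zero_mul := fun x => by
      funext K
      simp [mul_coeff, zero_coeff]
    mul_zero := fun x => by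
      funext K
      simp [mul_coeff, zero_coeff]
    mul_assoc := SuperMech.mul_assoc
    one_mul := fun x => by
      funext K
      rw [mul_coeff, Finset.sum_eq_single ∅]
      · simp [one_coeff, crossings]
      · intro I _ hI
        simp [one_coeff, hI]
      · simp
    mul_one := fun x => by
      funext K
      rw [mul_coeff, Finset.sum_eq_single K]
      · simp [one_coeff, crossings]
      · intro I hI hIK
        have : K \ I ≠ ∅ := fun h =>
          hIK (Finset.Subset.antisymm (Finset.mem_powerset.1 hI) (Finset.sdiff_eq_empty_iff_subset.1 h))
        simp [one_coeff, this]
      · simp }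

end Algebra

/-- The sign `(-1) ^ a` for `a : ZMod 2`. -/
def sgn (a : ZMod 2) : ℤ := if a = 0 then 1 else -1

section Variables

variable (𝕜 γ : Type*) [RCLike 𝕜] [LinearOrder γ]

/-- The even (`a = 0`, bosonic) or odd (`a = 1`, fermionic) part of the Grassmann algebra. -/
def part (a : ZMod 2) : Submodule ℝ (Grassmann 𝕜 γ) where
  carrier := {x | ∀ K : Finset γ, (K.card : ZMod 2) ≠ a → x K = 0}
  zero_mem' := fun _ _ => rfl
  add_mem' := fun {x y} hx hy K hK => by
    rw [add_coeff, hx K hK, hy K hK, add_zero]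
  smul_mem' := fun c x hx K hK => by
    change c • x K = 0
    rw [hx K hK, smul_zero]

variable {𝕜 γ}

/-- The homogeneous component of degree `a`. -/
def homog (a : ZMod 2) (x : Grassmann 𝕜 γ) : part 𝕜 γ a :=
  ⟨fun K => if (K.card : ZMod 2) = a then x K else 0, fun _ hK => if_neg hK⟩

variable (𝕜 γ)

/-- Values of a family of variables, the variable `M` being bosonic or fermionic according to
`par M`. -/
abbrev Vars {κ : Type*} (par : κ → ZMod 2) : Type _ := ∀ M : κ, part 𝕜 γ (par M)

/-- A time together with values of the variables. -/
abbrev Pt {κ : Type*} (par : κ → ZMod 2) : Type _ := ℝ × Vars 𝕜 γ par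

end Variables

section Calculus

variable {𝕜 γ κ : Type*} [RCLike 𝕜] [LinearOrder γ] [Fintype κ] {par : κ → ZMod 2}

/-- `D = (D.1, D.2)` are the time derivative and the *left* derivatives of `F` at `x`: under every
variation `(τ, h)` of the point, `δF = τ ∂F/∂t + ∑ M, h M * ∂F/∂z M` (coefficient by coefficient). -/
def IsLeftDiffAt (F : Pt 𝕜 γ par → Grassmann 𝕜 γ) (D : Grassmann 𝕜 γ × (κ → Grassmann 𝕜 γ))
    (x : Pt 𝕜 γ par) : Prop :=
  ∀ (τ : ℝ) (h : Vars 𝕜 γ par) (K : Finset γ),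
    HasDerivAt (fun s : ℝ => F (x + s • ((τ, h) : Pt 𝕜 γ par)) K)
      ((τ • D.1 + ∑ M, (h M : Grassmann 𝕜 γ) * D.2 M : Grassmann 𝕜 γ) K) 0

open Classical in
/-- The partial derivative with respect to the explicit time. -/
noncomputable def timeDeriv (F : Pt 𝕜 γ par → Grassmann 𝕜 γ) (x : Pt 𝕜 γ par) : Grassmann 𝕜 γ :=
  if h : ∃ D, IsLeftDiffAt F D x then h.choose.1 else 0

open Classical in
/-- The left partial derivative with respect to the variable `M`. -/
noncomputable def leftDeriv (F : Pt 𝕜 γ par → Grassmann 𝕜 γ) (M : κ) (x : Pt 𝕜 γ par) :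
    Grassmann 𝕜 γ :=
  if h : ∃ D, IsLeftDiffAt F D x then h.choose.2 M else 0

/-- `k` times continuously superdifferentiable functions on `U`. -/
def SuperC : ℕ → Set (Pt 𝕜 γ par) → (Pt 𝕜 γ par → Grassmann 𝕜 γ) → Prop
  | 0, U, F => ContinuousOn F U
  | k + 1, U, F => ContinuousOn F U ∧
      ∃ (Dt : Pt 𝕜 γ par → Grassmann 𝕜 γ) (D : κ → Pt 𝕜 γ par → Grassmann 𝕜 γ),
        SuperC k U Dt ∧ (∀ M, SuperC k U (D M)) ∧
          ∀ x ∈ U, IsLeftDiffAt F (Dt x, fun M => D M x) x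

/-- Supersmooth functions on `U`, homogeneous of degree `a`. -/
structure IsSuperfunction (a : ZMod 2) (U : Set (Pt 𝕜 γ par))
    (F : Pt 𝕜 γ par → Grassmann 𝕜 γ) : Prop where
  smooth : ∀ k, SuperC k U F
  parity : ∀ x ∈ U, F x ∈ part 𝕜 γ a

end Calculus

section Mechanics

variable (𝕜 γ : Type*) [RCLike 𝕜] [LinearOrder γ] {ι : Type*} (par : ι → ZMod 2)
  (P R : Finset ι)

/-- Points `(t, q, q̇)`: `.inl A` is the position `q A` and `.inr A` the velocity `q̇ A`. -/
abbrev VelPt : Type _ := Pt 𝕜 γ (Sum.elim par par)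

/-- Points `(t, q, p)` of the full phase space: `.inl A` is the position `q A` and `.inr A` the
momentum `p A`. -/
abbrev PhasePt : Type _ := Pt 𝕜 γ (Sum.elim par par)

/-- Points `(t, q, p_a)`, where `a` runs over the indices outside `P`. -/
abbrev RedPt : Type _ := Pt 𝕜 γ (Sum.elim par fun a : {A // A ∉ P} => par a)

/-- Points `(t, q, p_a, q̇^m̂)`, where `a` runs over the indices outside `P` and `m̂` over `R`. -/
abbrev HatPt : Type _ :=
  Pt 𝕜 γ (Sum.elim par (Sum.elim (fun a : {A // A ∉ P} => par a) fun m : {A // A ∈ R} => par m))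

variable {𝕜 γ par P R}

/-- Forget the momenta `p_m`, `m ∈ P`. -/
def toRed (P : Finset ι) (y : PhasePt 𝕜 γ par) : RedPt 𝕜 γ par P :=
  (y.1, fun
    | .inl A => y.2 (.inl A)
    | .inr a => y.2 (.inr a.1))

/-- Forget the velocities `q̇^m̂`. -/
def hatToRed (w : HatPt 𝕜 γ par P R) : RedPt 𝕜 γ par P :=
  (w.1, fun
    | .inl A => w.2 (.inl A)
    | .inr a => w.2 (.inr (.inl a)))

variable [Fintype ι] [DecidableEq ι]

/-- The momentum `∂L/∂q̇^A` as a function of `(t, q, q̇)`. -/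
noncomputable def momentum (L : VelPt 𝕜 γ par → Grassmann 𝕜 γ) (A : ι) :
    VelPt 𝕜 γ par → Grassmann 𝕜 γ :=
  leftDeriv L (.inr A)

/-- The total time derivative `dF/dt` of a function of `(t, q, q̇)`, with accelerations `a`. -/
noncomputable def totalDeriv (F : VelPt 𝕜 γ par → Grassmann 𝕜 γ) (x : VelPt 𝕜 γ par)
    (a : Vars 𝕜 γ par) : Grassmann 𝕜 γ :=
  timeDeriv F x + ∑ A, (x.2 (.inr A) : Grassmann 𝕜 γ) * leftDeriv F (.inl A) x
    + ∑ A, (a A : Grassmann 𝕜 γ) * leftDeriv F (.inr A) x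

/-- The variation `δF = δq^A ∂F/∂q^A + (d(δq^A)/dt) ∂F/∂q̇^A`. -/
noncomputable def variation (δq : ι → VelPt 𝕜 γ par → Grassmann 𝕜 γ)
    (F : VelPt 𝕜 γ par → Grassmann 𝕜 γ) (x : VelPt 𝕜 γ par) (a : Vars 𝕜 γ par) : Grassmann 𝕜 γ :=
  ∑ A, δq A x * leftDeriv F (.inl A) x + ∑ A, totalDeriv (δq A) x a * leftDeriv F (.inr A) x

/-- `δq(q, q̇, t)` is an infinitesimal symmetry of the Lagrangian `L` on `U`:
`δL = d(δK)/dt` identically in `(t, q, q̇, q̈)`. -/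
structure IsLagrangianSymmetry (U : Set (VelPt 𝕜 γ par)) (L : VelPt 𝕜 γ par → Grassmann 𝕜 γ)
    (δq : ι → VelPt 𝕜 γ par → Grassmann 𝕜 γ) (δK : VelPt 𝕜 γ par → Grassmann 𝕜 γ) : Prop where
  superfunction_q : ∀ A, IsSuperfunction (par A) U (δq A)
  superfunction_K : IsSuperfunction 0 U δK
  variation_eq : ∀ x ∈ U, ∀ a : Vars 𝕜 γ par, variation δq L x a = totalDeriv δK x a

/-- The Euler-Lagrange expression `d/dt (∂L/∂q̇^A) - ∂L/∂q^A`. -/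
noncomputable def eulerLagrange (L : VelPt 𝕜 γ par → Grassmann 𝕜 γ) (A : ι) (x : VelPt 𝕜 γ par)
    (a : Vars 𝕜 γ par) : Grassmann 𝕜 γ :=
  totalDeriv (momentum L A) x a - leftDeriv L (.inl A) x

/-- The transformation of the momentum `p_A` as a function of `(t, q, q̇)`. -/
noncomputable def deltaP (L : VelPt 𝕜 γ par → Grassmann 𝕜 γ)
    (δq : ι → VelPt 𝕜 γ par → Grassmann 𝕜 γ) (δK : VelPt 𝕜 γ par → Grassmann 𝕜 γ) (A : ι)
    (x : VelPt 𝕜 γ par) : Grassmann 𝕜 γ :=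
  leftDeriv δK (.inl A) x - ∑ B, leftDeriv (δq B) (.inl A) x * momentum L B x

/-- The positions of `x` and `r` agree at the same time, and the independent momenta `p_a` of `r`
are the values of `∂L/∂q̇^a` at `x`. -/
def LiesOver (L : VelPt 𝕜 γ par → Grassmann 𝕜 γ) (x : VelPt 𝕜 γ par) (r : RedPt 𝕜 γ par P) :
    Prop :=
  x.1 = r.1 ∧ (∀ A, (x.2 (.inl A) : Grassmann 𝕜 γ) = r.2 (.inl A)) ∧
    ∀ a : {A // A ∉ P}, momentum L a x = r.2 (.inr a)

/-- The relations `p_m = ∂L/∂q̇^m` and `p_a = ∂L/∂q̇^a` have been solved on `U` in the form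
`q̇^â = h^â(q, p_a, q̇^m̂, t)` and `p_m = f_m(q, p_a, t)`.  Here `m` runs over `P` and `a` over its
complement, `m̂` runs over `R` and `â` over its complement; `W` is the domain of the variables
`(t, q, p_a, q̇^m̂)`. -/
structure IsPrimaryReduction (U : Set (VelPt 𝕜 γ par)) (L : VelPt 𝕜 γ par → Grassmann 𝕜 γ)
    (W : Set (HatPt 𝕜 γ par P R)) (h : {A // A ∉ R} → HatPt 𝕜 γ par P R → Grassmann 𝕜 γ)
    (f : {A // A ∈ P} → RedPt 𝕜 γ par P → Grassmann 𝕜 γ) : Prop where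
  isOpen : IsOpen W
  superfunction_h : ∀ b : {A // A ∉ R}, IsSuperfunction (par b) W (h b)
  superfunction_f : ∀ m : {A // A ∈ P}, IsSuperfunction (par m) (hatToRed '' W) (f m)
  -- one-to-one correspondence between `(t, q, q̇)` in `U` and `(t, q, p_a, q̇^m̂)` in `W`
  correspondence : ∀ (x : VelPt 𝕜 γ par) (w : HatPt 𝕜 γ par P R),
    (x ∈ U ∧ LiesOver L x (hatToRed w) ∧
        ∀ m : {A // A ∈ R}, (x.2 (.inr m.1) : Grassmann 𝕜 γ) = w.2 (.inr (.inr m))) ↔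
      (w ∈ W ∧ x.1 = w.1 ∧ (∀ A, (x.2 (.inl A) : Grassmann 𝕜 γ) = w.2 (.inl A)) ∧
        (∀ b : {A // A ∉ R}, (x.2 (.inr b.1) : Grassmann 𝕜 γ) = h b w) ∧
        ∀ m : {A // A ∈ R}, (x.2 (.inr m.1) : Grassmann 𝕜 γ) = w.2 (.inr (.inr m)))
  constraint : ∀ x ∈ U, ∀ r : RedPt 𝕜 γ par P, LiesOver L x r →
    ∀ m : {A // A ∈ P}, momentum L m x = f m r
  -- the range of the free velocities `q̇^m̂` at given `(t, q, p_a)` is connected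
  fibre_connected : ∀ r : RedPt 𝕜 γ par P, IsPreconnected {w | w ∈ W ∧ hatToRed w = r}

/-- The primary constraint `φ_m = p_m - f_m(q, p_a, t)` on the full phase space. -/
def constraintFn (f : {A // A ∈ P} → RedPt 𝕜 γ par P → Grassmann 𝕜 γ) (m : {A // A ∈ P})
    (y : PhasePt 𝕜 γ par) : Grassmann 𝕜 γ :=
  (y.2 (.inr m.1) : Grassmann 𝕜 γ) - f m (toRed P y)

open Classical in
/-- The canonical Hamiltonian `H(q, p_a, t) = q̇^A p_A - L`, evaluated at any velocity in `U`
compatible with `(t, q, p_a)`. -/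
noncomputable def canonicalH (U : Set (VelPt 𝕜 γ par)) (L : VelPt 𝕜 γ par → Grassmann 𝕜 γ)
    (r : RedPt 𝕜 γ par P) : Grassmann 𝕜 γ :=
  if hr : ∃ x, x ∈ U ∧ LiesOver L x r then
    ∑ A, (hr.choose.2 (.inr A) : Grassmann 𝕜 γ) * momentum L A hr.choose - L hr.choose
  else 0

/-- The total Hamiltonian `H_T = H + φ_m u^m` with multipliers `u^m(p, q, t)`. -/
noncomputable def totalH (U : Set (VelPt 𝕜 γ par)) (L : VelPt 𝕜 γ par → Grassmann 𝕜 γ)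
    (f : {A // A ∈ P} → RedPt 𝕜 γ par P → Grassmann 𝕜 γ)
    (u : {A // A ∈ P} → PhasePt 𝕜 γ par → Grassmann 𝕜 γ) (y : PhasePt 𝕜 γ par) : Grassmann 𝕜 γ :=
  canonicalH U L (toRed P y) + ∑ m, constraintFn f m y * u m y

/-- The velocity `q̇^A(q, p_a, q̇^m, t) = (-1)^A ∂H/∂p_A + (-1)^(A (1 + m)) q̇^m ∂φ_m/∂p_A`, at
the phase space point `y` and the values `w m` of the velocities `q̇^m`, `m ∈ P`. -/
noncomputable def velocity (U : Set (VelPt 𝕜 γ par)) (L : VelPt 𝕜 γ par → Grassmann 𝕜 γ)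
    (f : {A // A ∈ P} → RedPt 𝕜 γ par P → Grassmann 𝕜 γ) (w : {A // A ∈ P} → Grassmann 𝕜 γ)
    (A : ι) (y : PhasePt 𝕜 γ par) : Grassmann 𝕜 γ :=
  sgn (par A) • leftDeriv (fun z : PhasePt 𝕜 γ par => canonicalH U L (toRed P z)) (.inr A) y
    + ∑ m : {A // A ∈ P}, sgn (par A * (1 + par m)) • (w m * leftDeriv (constraintFn f m) (.inr A) y)

/-- The point `(t, q, q̇)` obtained from `(t, q, p)` by expressing the velocities through
`(q, p_a, q̇^m, t)` and substituting `q̇^m = (-1)^m u^m(p, q, t)`.  (The velocity of index `A` is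
homogeneous of degree `par A`, so that `homog` only records this.) -/
noncomputable def velAt (U : Set (VelPt 𝕜 γ par)) (L : VelPt 𝕜 γ par → Grassmann 𝕜 γ)
    (f : {A // A ∈ P} → RedPt 𝕜 γ par P → Grassmann 𝕜 γ)
    (u : {A // A ∈ P} → PhasePt 𝕜 γ par → Grassmann 𝕜 γ) (y : PhasePt 𝕜 γ par) : VelPt 𝕜 γ par :=
  (y.1, fun
    | .inl A => y.2 (.inl A)
    | .inr A => homog (par A) (velocity U L f (fun m => sgn (par m) • u m y) A y))

/-- The total Noether charge `Q_T = Δq^A p_A - δK`, where the full momenta `p_A` appear and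
`Δq^A`, `δK` are evaluated at the velocities `velAt`. -/
noncomputable def totalNoether (U : Set (VelPt 𝕜 γ par)) (L : VelPt 𝕜 γ par → Grassmann 𝕜 γ)
    (f : {A // A ∈ P} → RedPt 𝕜 γ par P → Grassmann 𝕜 γ)
    (u : {A // A ∈ P} → PhasePt 𝕜 γ par → Grassmann 𝕜 γ)
    (δq : ι → VelPt 𝕜 γ par → Grassmann 𝕜 γ) (δK : VelPt 𝕜 γ par → Grassmann 𝕜 γ)
    (y : PhasePt 𝕜 γ par) : Grassmann 𝕜 γ :=
  ∑ A, δq A (velAt U L f u y) * (y.2 (.inr A) : Grassmann 𝕜 γ) - δK (velAt U L f u y)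

/-- The Poisson bracket `[F, G}` of phase space functions, `F` being homogeneous of degree `d`. -/
noncomputable def poisson (d : ZMod 2) (F G : PhasePt 𝕜 γ par → Grassmann 𝕜 γ)
    (y : PhasePt 𝕜 γ par) : Grassmann 𝕜 γ :=
  ∑ A, (sgn (par A * d) • (leftDeriv F (.inl A) y * leftDeriv G (.inr A) y)
    - sgn (par A * (d + 1)) • (leftDeriv F (.inr A) y * leftDeriv G (.inl A) y))

end Mechanics

end SuperMech

open SuperMech

/-!
# The total Noether charge of a singular Lagrangian system with bosons and fermions

The superderivatives are handled through their differentials: `leftDifferential (grad F x) v` is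
the derivative of `F` at `x` in the direction `v`, in which the components of `v` stand to the left
of the left derivatives.  Variations obey the Leibniz rule without signs, so all computations are
done with variations; signs appear only when left derivatives are read off at the end, by cancelling
an arbitrary homogeneous element on the left (`eq_of_part_mul_eq`).  Superdifferentiability is a
condition on lines, but continuity of the derivatives upgrades it to a first order Taylor estimate
(`C1At.isLittleO`).  This gives the chain rule (`C1At.curveDeriv`, `C1At.comp`) and the symmetry of
second derivatives (`hessian_symm`).

Since the accelerations are arbitrary, the Noether identity `δL = dδK/dt` splits into
`∂δq^B/∂q̇^A p_B = ∂δK/∂q̇^A` (`IsLagrangianSymmetry.sum_leftDeriv_mul_momentum`) and a part free of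
accelerations (`IsLagrangianSymmetry.noether_identity`).  The formula for `δp_A` follows by
differentiating the Noether identity with respect to `q̇^A` and subtracting the total time
derivative of the first part (`IsLagrangianSymmetry.deltaP_eq`).

The energy `q̇^A p_A - L`, as a function of `(t, q, p_a, q̇^m̂)`, has the variation
`q̇^A δp_A - δq^A ∂L/∂q^A - δt ∂L/∂t`, in which `δq̇^A` cancels.  So it is locally constant in the
free velocities, hence constant because their range is connected, and the canonical Hamiltonian is
this energy at any choice of the free velocities (`IsPrimaryReduction.canonicalH_eq`).  Fixing them
locally shows that the Hamiltonian is superdifferentiable, and its variation recovers the velocities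
(`IsPrimaryReduction.velocity_eq`).

On the primary constraint surface the momenta are the derivatives of `L` at the velocities `velAt`.
There
* `δH_T = q̇^A δp_A - δq^A ∂L/∂q^A - δt ∂L/∂t` (`IsPrimaryReduction.leftDifferential_totalH`);
* `δQ_T = Δq^A δp_A - δq^A Δp_A + δt (∂δq^A/∂t p_A - ∂δK/∂t)`, as the variations of the velocities
  cancel by the first part of the Noether identity
  (`IsPrimaryReduction.leftDifferential_totalNoether`).

The brackets with `q^A` and `p_A` are read off from `δQ_T`, and the conservation law is the part of
the Noether identity free of accelerations.
-/

set_option linter.unusedSectionVars false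

namespace SuperMech

/-! ### Signs, parity and cancellation in the Grassmann algebra -/

theorem sgn_add : ∀ a b : ZMod 2, sgn (a + b) = sgn a * sgn b := by decide

theorem sgn_mul_self_eq_one : ∀ a : ZMod 2, sgn a * sgn a = 1 := by decide

theorem sgn_self_mul : ∀ a : ZMod 2, sgn (a * a) = sgn a := by decide

theorem sgn_natCast (n : ℕ) : sgn (n : ZMod 2) = (-1) ^ n := by
  induction n with
  | zero => rfl
  | succ n ih =>
    rw [Nat.cast_succ, sgn_add, ih, pow_succ]
    rfl

theorem sgn_smul_sgn_smul {M : Type*} [AddCommGroup M] (a : ZMod 2) (x : M) :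
    sgn a • sgn a • x = x := by
  rw [smul_smul, sgn_mul_self_eq_one, one_smul]

section Coefficients

variable {𝕜 γ : Type*} [RCLike 𝕜]

theorem sub_coeff (x y : Grassmann 𝕜 γ) (K : Finset γ) : (x - y) K = x K - y K := rfl

theorem smul_coeff (c : ℝ) (x : Grassmann 𝕜 γ) (K : Finset γ) : (c • x) K = c • x K := rfl

/-- The coefficient at the monomial `K`, as an additive homomorphism. -/
def coeffHom (K : Finset γ) : Grassmann 𝕜 γ →+ 𝕜 where
  toFun x := x K
  map_zero' := rfl
  map_add' _ _ := rfl

theorem zsmul_coeff (n : ℤ) (x : Grassmann 𝕜 γ) (K : Finset γ) : (n • x) K = n • x K :=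
  map_zsmul (coeffHom K) n x

theorem sum_coeff {α : Type*} (s : Finset α) (x : α → Grassmann 𝕜 γ) (K : Finset γ) :
    (∑ i ∈ s, x i) K = ∑ i ∈ s, x i K :=
  map_sum (coeffHom K) x s

instance : LocallyConvexSpace ℝ (Grassmann 𝕜 γ) :=
  inferInstanceAs (LocallyConvexSpace ℝ (Finset γ → 𝕜))

theorem tendsto_iff_coeff {α : Type*} {l : Filter α} {F : α → Grassmann 𝕜 γ}
    {x : Grassmann 𝕜 γ} : Tendsto F l (𝓝 x) ↔ ∀ K, Tendsto (fun i => F i K) l (𝓝 (x K)) :=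
  tendsto_pi_nhds (A := fun _ : Finset γ => 𝕜)

variable [LinearOrder γ]

theorem real_smul_mul (c : ℝ) (x y : Grassmann 𝕜 γ) : c • x * y = c • (x * y) := by
  funext K
  simp only [mul_coeff, smul_coeff, Finset.smul_sum]
  refine Finset.sum_congr rfl fun I _ => ?_
  simp only [Algebra.smul_def]
  ring

theorem mul_real_smul (c : ℝ) (x y : Grassmann 𝕜 γ) : x * c • y = c • (x * y) := by
  funext K
  simp only [mul_coeff, smul_coeff, Finset.smul_sum]
  refine Finset.sum_congr rfl fun I _ => ?_
  simp only [Algebra.smul_def]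
  ring

theorem mul_mem_part {a b : ZMod 2} {x y : Grassmann 𝕜 γ} (hx : x ∈ part 𝕜 γ a)
    (hy : y ∈ part 𝕜 γ b) : x * y ∈ part 𝕜 γ (a + b) := by
  intro K hK
  rw [mul_coeff]
  refine Finset.sum_eq_zero fun I hI => ?_
  by_cases h1 : (I.card : ZMod 2) = a
  · have h2 : ((K \ I).card : ZMod 2) ≠ b := by
      rintro rfl
      refine hK ?_
      rw [← h1, ← Nat.cast_add, add_comm,
        Finset.card_sdiff_add_card_eq_card (Finset.mem_powerset.1 hI)]
    rw [hy _ h2, mul_zero, mul_zero]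
  · rw [hx _ h1, zero_mul, mul_zero]

theorem zsmul_mem_part {a : ZMod 2} (n : ℤ) {x : Grassmann 𝕜 γ} (hx : x ∈ part 𝕜 γ a) :
    n • x ∈ part 𝕜 γ a := by
  intro K hK
  rw [zsmul_coeff, hx K hK, smul_zero]

theorem homog_coe {a : ZMod 2} {x : Grassmann 𝕜 γ} (hx : x ∈ part 𝕜 γ a) :
    (homog a x : Grassmann 𝕜 γ) = x := by
  funext K
  change (if (K.card : ZMod 2) = a then x K else 0) = x K
  split_ifs with h
  · rfl
  · exact (hx K h).symm

/-- For disjoint monomials, each pair of generators crosses in exactly one of the two orders. -/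
theorem crossings_add_crossings {I J : Finset γ} (h : Disjoint I J) :
    crossings I J + crossings J I = I.card * J.card := by
  have e : crossings J I = ((I ×ˢ J).filter fun p => ¬ p.2 < p.1).card := by
    unfold crossings
    refine Finset.card_bij (fun p _ => p.swap) ?_ ?_ ?_
    · rintro ⟨a, b⟩ hp
      simp only [Finset.mem_filter, Finset.mem_product, Prod.swap] at hp ⊢
      exact ⟨hp.1.symm, not_lt.2 hp.2.le⟩
    · rintro ⟨a, b⟩ _ ⟨c, d⟩ _ hs
      simpa [Prod.swap, and_comm] using hs
    · rintro ⟨a, b⟩ hp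
      simp only [Finset.mem_filter, Finset.mem_product] at hp
      refine ⟨(b, a), ?_, rfl⟩
      simp only [Finset.mem_filter, Finset.mem_product]
      refine ⟨hp.1.symm, lt_of_le_of_ne (not_lt.1 hp.2) ?_⟩
      rintro rfl
      exact Finset.disjoint_left.1 h hp.1.1 hp.1.2
  rw [e, crossings, Finset.card_filter_add_card_filter_not, Finset.card_product]

/-- Supercommutativity of the Grassmann algebra. -/
theorem mul_comm_of_mem_part {a b : ZMod 2} {x y : Grassmann 𝕜 γ} (hx : x ∈ part 𝕜 γ a)
    (hy : y ∈ part 𝕜 γ b) : x * y = sgn (a * b) • (y * x) := by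
  funext K
  rw [zsmul_coeff, mul_coeff, mul_coeff, Finset.smul_sum]
  refine Finset.sum_bij' (fun I _ => K \ I) (fun I _ => K \ I) ?_ ?_ ?_ ?_ ?_
  · intro I _
    exact Finset.mem_powerset.2 Finset.sdiff_subset
  · intro I _
    exact Finset.mem_powerset.2 Finset.sdiff_subset
  · intro I hI
    exact Finset.sdiff_sdiff_eq_self (Finset.mem_powerset.1 hI)
  · intro I hI
    exact Finset.sdiff_sdiff_eq_self (Finset.mem_powerset.1 hI)
  · intro I hI
    rw [Finset.sdiff_sdiff_eq_self (Finset.mem_powerset.1 hI)]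
    by_cases h1 : (I.card : ZMod 2) = a
    · by_cases h2 : ((K \ I).card : ZMod 2) = b
      · rw [← h1, ← h2, ← Nat.cast_mul, sgn_natCast,
          ← crossings_add_crossings (Finset.disjoint_sdiff : Disjoint I (K \ I)), zsmul_eq_mul]
        have h3 : ((-1 : 𝕜) ^ crossings (K \ I) I) * (-1) ^ crossings (K \ I) I = 1 := by
          rw [← mul_pow]
          simp
        push_cast
        rw [pow_add]
        linear_combination (-(-1) ^ crossings I (K \ I) * (x I * y (K \ I))) * h3
      · rw [hy _ h2]
        simp
    · rw [hx _ h1]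
      simp

/-- An element annihilated by all elements of a parity vanishes.  For odd parity this needs
infinitely many generators: a product of all of finitely many generators is annihilated by each
of them. -/
theorem eq_zero_of_part_mul_eq_zero {a : ZMod 2} (ha : Infinite γ ∨ a = 0) {x : Grassmann 𝕜 γ}
    (hx : ∀ h : part 𝕜 γ a, (h : Grassmann 𝕜 γ) * x = 0) : x = 0 := by
  by_cases h0 : a = 0
  · subst h0
    have h1 : (1 : Grassmann 𝕜 γ) ∈ part 𝕜 γ 0 := by
      intro K hK
      rw [one_coeff, if_neg]
      rintro rfl
      simp at hK
    simpa using hx ⟨1, h1⟩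
  · have : Infinite γ := ha.resolve_right h0
    have h1 : a = 1 := (by decide : ∀ a : ZMod 2, a ≠ 0 → a = 1) a h0
    subst h1
    funext K
    obtain ⟨i, hi⟩ := Infinite.exists_notMem_finset K
    have hm : (fun J => if J = {i} then 1 else 0 : Grassmann 𝕜 γ) ∈ part 𝕜 γ 1 := by
      intro J hJ
      refine if_neg ?_
      rintro rfl
      simp at hJ
    have h2 := congrFun (hx ⟨_, hm⟩) (insert i K)
    rw [mul_coeff, Finset.sum_eq_single {i}] at h2
    · have e : insert i K \ {i} = K := by
        ext j
        simp only [Finset.mem_sdiff, Finset.mem_insert, Finset.mem_singleton]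
        constructor
        · rintro ⟨h | h, h'⟩
          · exact absurd h h'
          · exact h
        · intro h
          exact ⟨Or.inr h, fun h' => hi (h' ▸ h)⟩
      rw [e] at h2
      simpa [zero_coeff] using h2
    · intro J _ hJ
      simp [hJ]
    · intro h
      simp at h

theorem eq_of_part_mul_eq {a : ZMod 2} (ha : Infinite γ ∨ a = 0) {x y : Grassmann 𝕜 γ}
    (h : ∀ h : part 𝕜 γ a, (h : Grassmann 𝕜 γ) * x = h * y) : x = y :=
  sub_eq_zero.1 <| eq_zero_of_part_mul_eq_zero ha fun k => by rw [mul_sub, h k, sub_self]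

/-- An element all of whose products with elements of parity `a` have parity `b` has parity
`b + a`. -/
theorem mem_part_of_part_mul_mem {a b : ZMod 2} (ha : Infinite γ ∨ a = 0) {x : Grassmann 𝕜 γ}
    (h : ∀ h : part 𝕜 γ a, (h : Grassmann 𝕜 γ) * x ∈ part 𝕜 γ b) : x ∈ part 𝕜 γ (b + a) := by
  have hx : x = homog (b + a) x := by
    refine eq_of_part_mul_eq ha fun k => ?_
    have h1 := h k
    have h2 : (k : Grassmann 𝕜 γ) * homog (b + a) x ∈ part 𝕜 γ b := by
      have := mul_mem_part k.2 (homog (b + a) x).2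
      rwa [(by decide : ∀ a b : ZMod 2, a + (b + a) = b) a b] at this
    have hr : x - homog (b + a) x ∈ part 𝕜 γ (b + a + 1) := by
      intro K hK
      have : (K.card : ZMod 2) = b + a :=
        (by decide : ∀ c d : ZMod 2, c ≠ d + 1 → c = d) _ _ hK
      rw [sub_coeff]
      change x K - (if (K.card : ZMod 2) = b + a then x K else 0) = 0
      rw [if_pos this, sub_self]
    have h3 := mul_mem_part k.2 hr
    rw [mul_sub] at h3
    have h4 := Submodule.sub_mem _ h1 h2
    refine sub_eq_zero.1 ?_
    funext K
    by_cases hK : (K.card : ZMod 2) = b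
    · refine h3 K ?_
      rw [hK]
      exact (by decide : ∀ a b : ZMod 2, b ≠ a + (b + a + 1)) a b
    · exact h4 K hK
  rw [hx]
  exact (homog (b + a) x).2

end Coefficients

/-! ### Derivatives along curves -/

section Curves

variable {𝕜 γ : Type*} [RCLike 𝕜] [LinearOrder γ]

/-- The curve `c` in the Grassmann algebra has derivative `c'` at parameter `0`, coefficient by
coefficient. -/
def CurveDeriv (c : ℝ → Grassmann 𝕜 γ) (c' : Grassmann 𝕜 γ) : Prop :=
  ∀ K, HasDerivAt (fun s => c s K) (c' K) 0

namespace CurveDeriv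

variable {b c : ℝ → Grassmann 𝕜 γ} {b' c' : Grassmann 𝕜 γ}

theorem unique (h : CurveDeriv c b') (h' : CurveDeriv c c') : b' = c' :=
  funext fun K => (h K).unique (h' K)

theorem congr (h : CurveDeriv c c') (e : b =ᶠ[𝓝 0] c) : CurveDeriv b c' := fun K =>
  (h K).congr_of_eventuallyEq (e.mono fun _ hs => congrFun hs K)

theorem const (x : Grassmann 𝕜 γ) : CurveDeriv (fun _ => x) 0 := fun K =>
  hasDerivAt_const (0 : ℝ) (x K)

theorem add (hb : CurveDeriv b b') (hc : CurveDeriv c c') :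
    CurveDeriv (fun s => b s + c s) (b' + c') := fun K => (hb K).add (hc K)

theorem sub (hb : CurveDeriv b b') (hc : CurveDeriv c c') :
    CurveDeriv (fun s => b s - c s) (b' - c') := fun K => (hb K).sub (hc K)

theorem zsmul (n : ℤ) (hc : CurveDeriv c c') : CurveDeriv (fun s => n • c s) (n • c') := fun K => by
  simp only [zsmul_coeff, zsmul_eq_mul]
  exact (hc K).const_mul (n : 𝕜)

theorem sum {α : Type*} {S : Finset α} {c : α → ℝ → Grassmann 𝕜 γ} {c' : α → Grassmann 𝕜 γ}
    (h : ∀ i ∈ S, CurveDeriv (c i) (c' i)) :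
    CurveDeriv (fun s => ∑ i ∈ S, c i s) (∑ i ∈ S, c' i) := fun K => by
  simp only [sum_coeff]
  exact HasDerivAt.fun_sum fun i hi => h i hi K

theorem mul (hb : CurveDeriv b b') (hc : CurveDeriv c c') :
    CurveDeriv (fun s => b s * c s) (b' * c 0 + b 0 * c') := fun K => by
  simp only [mul_coeff, add_coeff]
  rw [← Finset.sum_add_distrib]
  refine HasDerivAt.fun_sum fun I _ => ?_
  rw [← mul_add]
  exact ((hb I).mul (hc (K \ I))).const_mul _

theorem real_smul {r : ℝ → ℝ} {r' : ℝ} (hr : HasDerivAt r r' 0) (hc : CurveDeriv c c') :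
    CurveDeriv (fun s => r s • c s) (r' • c 0 + r 0 • c') := fun K => by
  have := hr.smul (hc K)
  rwa [add_comm] at this

theorem mem_part {a : ZMod 2} (hc : CurveDeriv c c') (h : ∀ᶠ s in 𝓝 0, c s ∈ part 𝕜 γ a) :
    c' ∈ part 𝕜 γ a := fun K hK =>
  (hc K).unique ((hasDerivAt_const (0 : ℝ) (0 : 𝕜)).congr_of_eventuallyEq
    (h.mono fun _ hs => hs K hK))

end CurveDeriv

end Curves

/-! ### Left differentials -/

/-- Either there are infinitely many Grassmann generators or all variables are bosonic: the
condition under which left derivatives are unique. -/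
def EnoughGenerators (γ : Type*) {κ : Type*} (par : κ → ZMod 2) : Prop :=
  Infinite γ ∨ ∀ M, par M = 0

section Differential

variable {𝕜 γ κ : Type*} [RCLike 𝕜] [LinearOrder γ] {par : κ → ZMod 2}

theorem EnoughGenerators.apply (hs : EnoughGenerators γ par) (M : κ) : Infinite γ ∨ par M = 0 :=
  hs.imp_right fun h => h M

theorem tendsto_pt_iff {α : Type*} {l : Filter α} {c : α → Pt 𝕜 γ par} {x : Pt 𝕜 γ par} :
    Tendsto c l (𝓝 x) ↔ Tendsto (fun i => (c i).1) l (𝓝 x.1) ∧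
      ∀ M K, Tendsto (fun i => ((c i).2 M : Grassmann 𝕜 γ) K) l
        (𝓝 ((x.2 M : Grassmann 𝕜 γ) K)) := by
  rw [Prod.tendsto_iff, tendsto_pi_nhds]
  simp only [tendsto_subtype_rng, tendsto_iff_coeff]

/-- The curve `c` of points has velocity `v` at parameter `0`. -/
structure PtCurveDeriv (c : ℝ → Pt 𝕜 γ par) (v : Pt 𝕜 γ par) : Prop where
  time : HasDerivAt (fun s => (c s).1) v.1 0
  var : ∀ M, CurveDeriv (fun s => ((c s).2 M : Grassmann 𝕜 γ)) (v.2 M)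

theorem PtCurveDeriv.tendsto {c : ℝ → Pt 𝕜 γ par} {v : Pt 𝕜 γ par} (hc : PtCurveDeriv c v) :
    Tendsto c (𝓝 0) (𝓝 (c 0)) :=
  tendsto_pt_iff.2 ⟨hc.time.continuousAt, fun M K => (hc.var M K).continuousAt⟩

theorem ptCurveDeriv_line (x v : Pt 𝕜 γ par) : PtCurveDeriv (fun s : ℝ => x + s • v) v := by
  refine ⟨?_, fun M K => ?_⟩
  · simpa using ((hasDerivAt_id (0 : ℝ)).mul_const v.1).const_add x.1
  · have := ((hasDerivAt_id (0 : ℝ)).smul_const ((v.2 M : Grassmann 𝕜 γ) K)).const_add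
      ((x.2 M : Grassmann 𝕜 γ) K)
    rw [one_smul] at this
    exact this

theorem line_zero (x v : Pt 𝕜 γ par) : x + (0 : ℝ) • v = x := by
  rw [zero_smul, add_zero]

theorem tendsto_line (x v : Pt 𝕜 γ par) : Tendsto (fun s : ℝ => x + s • v) (𝓝 0) (𝓝 x) := by
  simpa only [line_zero] using (ptCurveDeriv_line x v).tendsto

variable [Fintype κ]

/-- The variation `τ D.1 + ∑ M, h M * D.2 M` in the direction `(τ, h)`, for given time derivative
`D.1` and left derivatives `D.2`. -/
noncomputable def leftDifferential (D : Grassmann 𝕜 γ × (κ → Grassmann 𝕜 γ)) (v : Pt 𝕜 γ par) :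
    Grassmann 𝕜 γ :=
  v.1 • D.1 + ∑ M, (v.2 M : Grassmann 𝕜 γ) * D.2 M

/-- The time derivative of `F` together with its left derivatives. -/
noncomputable def grad (F : Pt 𝕜 γ par → Grassmann 𝕜 γ) (x : Pt 𝕜 γ par) :
    Grassmann 𝕜 γ × (κ → Grassmann 𝕜 γ) :=
  (timeDeriv F x, fun M => leftDeriv F M x)

theorem isLeftDiffAt_iff {F : Pt 𝕜 γ par → Grassmann 𝕜 γ}
    {D : Grassmann 𝕜 γ × (κ → Grassmann 𝕜 γ)} {x : Pt 𝕜 γ par} :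
    IsLeftDiffAt F D x ↔
      ∀ v, CurveDeriv (fun s : ℝ => F (x + s • v)) (leftDifferential D v) :=
  ⟨fun h v K => h v.1 v.2 K, fun h τ k K => h (τ, k) K⟩

/-- `F` is superdifferentiable at `x`. -/
def SDiffAt (F : Pt 𝕜 γ par → Grassmann 𝕜 γ) (x : Pt 𝕜 γ par) : Prop :=
  ∃ D, IsLeftDiffAt F D x

theorem SDiffAt.isLeftDiffAt_grad {F : Pt 𝕜 γ par → Grassmann 𝕜 γ} {x : Pt 𝕜 γ par}
    (h : SDiffAt F x) : IsLeftDiffAt F (grad F x) x := by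
  have h' : ∃ D, IsLeftDiffAt F D x := h
  have e : grad F x = h'.choose := by
    unfold grad timeDeriv leftDeriv
    simp only [dif_pos h']
  rw [e]
  exact h'.choose_spec

theorem SDiffAt.curveDeriv_line {F : Pt 𝕜 γ par → Grassmann 𝕜 γ} {x : Pt 𝕜 γ par}
    (h : SDiffAt F x) (v : Pt 𝕜 γ par) :
    CurveDeriv (fun s : ℝ => F (x + s • v)) (leftDifferential (grad F x) v) :=
  isLeftDiffAt_iff.1 h.isLeftDiffAt_grad v

/-- The direction in which only the variable `M` is varied, by `k`. -/
noncomputable def single [DecidableEq κ] (M : κ) (k : part 𝕜 γ (par M)) : Pt 𝕜 γ par :=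
  (0, Pi.single M k)

theorem leftDifferential_single [DecidableEq κ] (D : Grassmann 𝕜 γ × (κ → Grassmann 𝕜 γ)) (M : κ)
    (k : part 𝕜 γ (par M)) : leftDifferential D (single M k) = k * D.2 M := by
  unfold leftDifferential single
  rw [Finset.sum_eq_single M]
  · simp
  · intro N _ hN
    simp [Pi.single_eq_of_ne hN]
  · simp

/-- The direction in which only the time is varied. -/
noncomputable def timeDirection (𝕜 γ : Type*) [RCLike 𝕜] [LinearOrder γ] {κ : Type*}
    (par : κ → ZMod 2) : Pt 𝕜 γ par :=
  (1, 0)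

theorem leftDifferential_timeDirection (D : Grassmann 𝕜 γ × (κ → Grassmann 𝕜 γ)) :
    leftDifferential D (timeDirection 𝕜 γ par) = D.1 := by
  simp [leftDifferential, timeDirection]

theorem leftDifferential_smul (D : Grassmann 𝕜 γ × (κ → Grassmann 𝕜 γ)) (r : ℝ)
    (v : Pt 𝕜 γ par) : leftDifferential D (r • v) = r • leftDifferential D v := by
  unfold leftDifferential
  rw [smul_add, Finset.smul_sum]
  congr 1
  · exact mul_smul _ _ _
  · exact Finset.sum_congr rfl fun M _ => real_smul_mul _ _ _

theorem leftDifferential_add (D : Grassmann 𝕜 γ × (κ → Grassmann 𝕜 γ)) (v w : Pt 𝕜 γ par) :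
    leftDifferential D (v + w) = leftDifferential D v + leftDifferential D w := by
  unfold leftDifferential
  have : ∀ M, ((v + w).2 M : Grassmann 𝕜 γ) * D.2 M = v.2 M * D.2 M + w.2 M * D.2 M := fun M =>
    add_mul _ _ _
  rw [Finset.sum_congr rfl fun M _ => this M, Finset.sum_add_distrib, Prod.fst_add, add_smul]
  abel

theorem leftDifferential_injective (hs : EnoughGenerators γ par)
    {D E : Grassmann 𝕜 γ × (κ → Grassmann 𝕜 γ)}
    (h : ∀ v : Pt 𝕜 γ par, leftDifferential D v = leftDifferential E v) : D = E := by
  classical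
  refine Prod.ext ?_ (funext fun M => eq_of_part_mul_eq (hs.apply M) fun k => ?_)
  · simpa only [leftDifferential_timeDirection] using h (timeDirection 𝕜 γ par)
  · simpa only [leftDifferential_single] using h (single M k)

theorem IsLeftDiffAt.grad_eq (hs : EnoughGenerators γ par) {F : Pt 𝕜 γ par → Grassmann 𝕜 γ}
    {D : Grassmann 𝕜 γ × (κ → Grassmann 𝕜 γ)} {x : Pt 𝕜 γ par} (h : IsLeftDiffAt F D x) :
    grad F x = D :=
  leftDifferential_injective hs fun v =>
    (SDiffAt.curveDeriv_line ⟨D, h⟩ v).unique (isLeftDiffAt_iff.1 h v)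

theorem IsLeftDiffAt.congr {F G : Pt 𝕜 γ par → Grassmann 𝕜 γ}
    {D : Grassmann 𝕜 γ × (κ → Grassmann 𝕜 γ)} {x : Pt 𝕜 γ par} (h : IsLeftDiffAt F D x)
    (e : G =ᶠ[𝓝 x] F) : IsLeftDiffAt G D x :=
  isLeftDiffAt_iff.2 fun v =>
    (isLeftDiffAt_iff.1 h v).congr ((tendsto_line x v).eventually e)

theorem SDiffAt.congr {F G : Pt 𝕜 γ par → Grassmann 𝕜 γ} {x : Pt 𝕜 γ par} (h : SDiffAt F x)
    (e : G =ᶠ[𝓝 x] F) : SDiffAt G x :=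
  h.imp fun _ hD => hD.congr e

theorem leftDifferential_mem_part {F : Pt 𝕜 γ par → Grassmann 𝕜 γ} {x : Pt 𝕜 γ par} {a : ZMod 2}
    (h : SDiffAt F x) (hp : ∀ᶠ z in 𝓝 x, F z ∈ part 𝕜 γ a) (v : Pt 𝕜 γ par) :
    leftDifferential (grad F x) v ∈ part 𝕜 γ a :=
  (h.curveDeriv_line v).mem_part ((tendsto_line x v).eventually hp)

theorem leftDeriv_mem_part (hs : EnoughGenerators γ par) {F : Pt 𝕜 γ par → Grassmann 𝕜 γ}
    {x : Pt 𝕜 γ par} {a : ZMod 2} (h : SDiffAt F x) (hp : ∀ᶠ z in 𝓝 x, F z ∈ part 𝕜 γ a) (M : κ) :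
    leftDeriv F M x ∈ part 𝕜 γ (a + par M) := by
  classical
  refine mem_part_of_part_mul_mem (hs.apply M) fun k => ?_
  have := leftDifferential_mem_part h hp (single M k)
  rwa [leftDifferential_single] at this

/-! ### The chain rule -/

/-- `F` is superdifferentiable near `x`, with derivatives that are continuous at `x`. -/
structure C1At (F : Pt 𝕜 γ par → Grassmann 𝕜 γ) (x : Pt 𝕜 γ par) : Prop where
  sdiff : ∀ᶠ z in 𝓝 x, SDiffAt F z
  time : ContinuousAt (timeDeriv F) x
  left : ∀ M, ContinuousAt (leftDeriv F M) x

theorem leftDifferential_coeff (D : Grassmann 𝕜 γ × (κ → Grassmann 𝕜 γ)) (v : Pt 𝕜 γ par)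
    (K : Finset γ) : leftDifferential D v K = v.1 • D.1 K + ∑ M, ∑ I ∈ K.powerset,
      (-1) ^ crossings I (K \ I) * ((v.2 M : Grassmann 𝕜 γ) I * D.2 M (K \ I)) := by
  simp only [leftDifferential, add_coeff, smul_coeff, sum_coeff, mul_coeff]

/-- The finitely many coefficients of the direction `v` that enter the coefficient at `K` of a
differential in this direction. -/
noncomputable def directionSize (K : Finset γ) (v : Pt 𝕜 γ par) : ℝ :=
  |v.1| + ∑ M, ∑ I ∈ K.powerset, ‖(v.2 M : Grassmann 𝕜 γ) I‖

theorem norm_leftDifferential_sub_le {D E : Grassmann 𝕜 γ × (κ → Grassmann 𝕜 γ)} {K : Finset γ}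
    {ε : ℝ} (h1 : ‖D.1 K - E.1 K‖ ≤ ε)
    (h2 : ∀ M, ∀ I ∈ K.powerset, ‖D.2 M I - E.2 M I‖ ≤ ε) (v : Pt 𝕜 γ par) :
    ‖leftDifferential D v K - leftDifferential E v K‖ ≤ ε * directionSize K v := by
  rw [leftDifferential_coeff, leftDifferential_coeff, directionSize, add_sub_add_comm, ← smul_sub,
    ← Finset.sum_sub_distrib, mul_add, Finset.mul_sum]
  refine (norm_add_le _ _).trans (add_le_add ?_ ((norm_sum_le _ _).trans
    (Finset.sum_le_sum fun M _ => ?_)))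
  · rw [norm_smul, Real.norm_eq_abs, mul_comm]
    exact mul_le_mul_of_nonneg_right h1 (abs_nonneg _)
  · rw [← Finset.sum_sub_distrib, Finset.mul_sum]
    refine (norm_sum_le _ _).trans (Finset.sum_le_sum fun I hI => ?_)
    rw [← mul_sub, ← mul_sub, norm_mul, norm_mul, norm_pow, norm_neg, norm_one, one_pow, one_mul,
      mul_comm]
    exact mul_le_mul_of_nonneg_right
      (h2 M _ (Finset.mem_powerset.2 Finset.sdiff_subset)) (norm_nonneg _)

theorem hasDerivAt_line {F : Pt 𝕜 γ par → Grassmann 𝕜 γ} {x v : Pt 𝕜 γ par} {r : ℝ}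
    {d : Grassmann 𝕜 γ} (h : CurveDeriv (fun s : ℝ => F (x + r • v + s • v)) d) (K : Finset γ) :
    HasDerivAt (fun s : ℝ => F (x + s • v) K) (d K) r := by
  have h2 : HasDerivAt (fun s : ℝ => F (x + r • v + s • v) K) (d K) (r - r) := by
    rw [sub_self]
    exact h K
  refine (h2.comp_sub_const r r).congr_of_eventuallyEq (Eventually.of_forall fun s => ?_)
  simp only
  rw [add_assoc, ← add_smul, add_sub_cancel]

instance : LocallyConvexSpace ℝ (Pt 𝕜 γ par) :=
  have (M : κ) : LocallyConvexSpace ℝ (part 𝕜 γ (par M)) :=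
    LocallyConvexSpace.induced (part 𝕜 γ (par M)).subtype
  inferInstance

/-- First order Taylor estimate.  It follows from the mean value inequality on a convex
neighbourhood, since a coefficient of the differential involves finitely many coefficients of the
direction. -/
theorem C1At.isLittleO {F : Pt 𝕜 γ par → Grassmann 𝕜 γ} {x : Pt 𝕜 γ par} (hF : C1At F x)
    {α : Type*} {l : Filter α} {c : α → Pt 𝕜 γ par} {φ : α → ℝ} (hc : Tendsto c l (𝓝 x))
    (h1 : (fun i => (c i).1 - x.1) =O[l] φ)
    (h2 : ∀ M K, (fun i => ((c i).2 M : Grassmann 𝕜 γ) K - (x.2 M : Grassmann 𝕜 γ) K) =O[l] φ)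
    (K : Finset γ) :
    (fun i => F (c i) K - F x K - leftDifferential (grad F x) (c i - x) K) =o[l] φ := by
  have hS : (fun i => directionSize K (c i - x)) =O[l] φ := by
    refine Asymptotics.IsBigO.add h1.norm_left (Asymptotics.IsBigO.fun_sum fun M _ =>
      Asymptotics.IsBigO.fun_sum fun I _ => (h2 M I).norm_left)
  refine Asymptotics.IsLittleO.trans_isBigO ?_ hS
  rw [Asymptotics.isLittleO_iff]
  intro ε hε
  have near (G : Pt 𝕜 γ par → Grassmann 𝕜 γ) (hG : ContinuousAt G x) (J : Finset γ) :
      ∀ᶠ z in 𝓝 x, ‖G z J - G x J‖ ≤ ε := by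
    have : Tendsto (fun z => ‖G z J - G x J‖) (𝓝 x) (𝓝 0) := by
      simpa only [sub_self, norm_zero] using ((tendsto_iff_coeff.1 hG J).sub_const (G x J)).norm
    exact (this.eventually (gt_mem_nhds hε)).mono fun _ h => le_of_lt h
  have hN : ∀ᶠ z in 𝓝 x, SDiffAt F z ∧ ‖timeDeriv F z K - timeDeriv F x K‖ ≤ ε ∧
      ∀ M, ∀ I ∈ K.powerset, ‖leftDeriv F M z I - leftDeriv F M x I‖ ≤ ε := by
    refine hF.sdiff.and ((near _ hF.time K).and (eventually_all.2 fun M => ?_))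
    rw [Filter.eventually_all_finset]
    exact fun I _ => near _ (hF.left M) I
  obtain ⟨N, ⟨hN1, hN2⟩, hN3⟩ :=
    (LocallyConvexSpace.convex_basis (𝕜 := ℝ) x).mem_iff.1 hN
  filter_upwards [hc hN1] with i hi
  set v := c i - x with hv
  have hseg : ∀ r ∈ Icc (0 : ℝ) 1, x + r • v ∈ N := fun r hr =>
    hN2.add_smul_sub_mem (mem_of_mem_nhds hN1) hi hr
  have hd : ∀ r ∈ Icc (0 : ℝ) 1, HasDerivWithinAt
      (fun s : ℝ => F (x + s • v) K - s • leftDifferential (grad F x) v K)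
      (leftDifferential (grad F (x + r • v)) v K - leftDifferential (grad F x) v K)
      (Icc 0 1) r := fun r hr => by
    have e1 := hasDerivAt_line ((hN3 (hseg r hr)).1.curveDeriv_line v) K
    have e2 := (hasDerivAt_id r).smul_const (leftDifferential (grad F x) v K)
    rw [one_smul] at e2
    exact (e1.sub e2).hasDerivWithinAt
  have hb := (convex_Icc (0 : ℝ) 1).norm_image_sub_le_of_norm_hasDerivWithin_le hd
    (fun r hr => norm_leftDifferential_sub_le (hN3 (hseg r hr)).2.1 (hN3 (hseg r hr)).2.2 v)
    (left_mem_Icc.2 zero_le_one) (right_mem_Icc.2 zero_le_one)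
  have hcx : x + v = c i := add_sub_cancel _ _
  simp only [one_smul, zero_smul, add_zero, sub_zero, hcx, norm_one, mul_one] at hb
  rw [sub_right_comm]
  refine hb.trans (mul_le_mul_of_nonneg_left (le_abs_self _) hε.le)

/-- The chain rule along a curve. -/
theorem C1At.curveDeriv {F : Pt 𝕜 γ par → Grassmann 𝕜 γ} {c : ℝ → Pt 𝕜 γ par} {v : Pt 𝕜 γ par}
    (hF : C1At F (c 0)) (hc : PtCurveDeriv c v) :
    CurveDeriv (fun s => F (c s)) (leftDifferential (grad F (c 0)) v) := fun K => by
  have h0 := hF.isLittleO hc.tendsto hc.time.isBigO_sub (fun M K => (hc.var M K).isBigO_sub) K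
  have hlin : HasDerivAt (fun s => leftDifferential (grad F (c 0)) (c s - c 0) K)
      (leftDifferential (grad F (c 0)) v K) 0 := by
    simp only [leftDifferential_coeff]
    refine ((hc.time.sub_const _).smul_const _).add (HasDerivAt.fun_sum fun M _ =>
      HasDerivAt.fun_sum fun I _ => ((((hc.var M I).sub_const _).mul_const _).const_mul _))
  rw [hasDerivAt_iff_isLittleO] at hlin ⊢
  refine (h0.norm_right.of_norm_right.add hlin).congr_left fun s => ?_
  have : leftDifferential (grad F (c 0)) (c 0 - c 0) K = 0 := by
    simp [leftDifferential_coeff, zero_coeff]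
  rw [this]
  simp

/-! ### Closure properties of superdifferentiability -/

section Closure

variable {F G : Pt 𝕜 γ par → Grassmann 𝕜 γ} {x : Pt 𝕜 γ par}

theorem sdiffAt_of_curveDeriv {D : Grassmann 𝕜 γ × (κ → Grassmann 𝕜 γ)}
    {ℓ : Pt 𝕜 γ par → Grassmann 𝕜 γ} (h : ∀ v, CurveDeriv (fun s : ℝ => F (x + s • v)) (ℓ v))
    (e : ∀ v, ℓ v = leftDifferential D v) : SDiffAt F x :=
  ⟨D, isLeftDiffAt_iff.2 fun v => e v ▸ h v⟩

theorem sdiffAt_const (y : Grassmann 𝕜 γ) (x : Pt 𝕜 γ par) : SDiffAt (fun _ => y) x :=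
  sdiffAt_of_curveDeriv (D := (0, fun _ => 0)) (fun _ => CurveDeriv.const y) fun v => by
    simp [leftDifferential]

theorem isLeftDiffAt_coord [DecidableEq κ] (M : κ) (x : Pt 𝕜 γ par) :
    IsLeftDiffAt (fun z => (z.2 M : Grassmann 𝕜 γ)) (0, Pi.single M 1) x := by
  refine isLeftDiffAt_iff.2 fun v => ?_
  have e : leftDifferential (0, Pi.single M 1) v = v.2 M := by
    unfold leftDifferential
    rw [Finset.sum_eq_single M]
    · simp
    · intro N _ hN
      simp [Pi.single_eq_of_ne hN]
    · simp
  rw [e]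
  exact (ptCurveDeriv_line x v).var M

theorem sdiffAt_coord (M : κ) (x : Pt 𝕜 γ par) :
    SDiffAt (fun z => (z.2 M : Grassmann 𝕜 γ)) x := by
  classical
  exact ⟨_, isLeftDiffAt_coord M x⟩

theorem leftDifferential_grad_coord (M : κ) (x v : Pt 𝕜 γ par) :
    leftDifferential (grad (fun z : Pt 𝕜 γ par => (z.2 M : Grassmann 𝕜 γ)) x) v = v.2 M :=
  ((sdiffAt_coord M x).curveDeriv_line v).unique ((ptCurveDeriv_line x v).var M)

theorem SDiffAt.add (hF : SDiffAt F x) (hG : SDiffAt G x) : SDiffAt (fun z => F z + G z) x :=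
  sdiffAt_of_curveDeriv
    (D := ((grad F x).1 + (grad G x).1, fun M => (grad F x).2 M + (grad G x).2 M))
    (fun v => (hF.curveDeriv_line v).add (hG.curveDeriv_line v)) fun v => by
      simp only [leftDifferential, mul_add, Finset.sum_add_distrib, smul_add]
      abel

theorem SDiffAt.zsmul (n : ℤ) (hF : SDiffAt F x) : SDiffAt (fun z => n • F z) x :=
  sdiffAt_of_curveDeriv (D := (n • (grad F x).1, fun M => n • (grad F x).2 M))
    (fun v => (hF.curveDeriv_line v).zsmul n) fun v => by
      simp only [leftDifferential, smul_add, Finset.smul_sum, smul_comm n]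
      congr 1
      exact Finset.sum_congr rfl fun M _ => (mul_smul_comm _ _ _).symm

theorem SDiffAt.sub (hF : SDiffAt F x) (hG : SDiffAt G x) : SDiffAt (fun z => F z - G z) x := by
  refine (hF.add (hG.zsmul (-1))).congr (Eventually.of_forall fun z => ?_)
  simp [sub_eq_add_neg]

theorem SDiffAt.sum {α : Type*} {S : Finset α} {F : α → Pt 𝕜 γ par → Grassmann 𝕜 γ}
    (h : ∀ i ∈ S, SDiffAt (F i) x) : SDiffAt (fun z => ∑ i ∈ S, F i z) x := by
  classical
  induction S using Finset.induction_on with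
  | empty => simpa using sdiffAt_const (0 : Grassmann 𝕜 γ) x
  | insert i S hi ih =>
    simp only [Finset.sum_insert hi]
    exact (h i (Finset.mem_insert_self i S)).add
      (ih fun j hj => h j (Finset.mem_insert_of_mem hj))

/-- The homogeneity of `F x` allows the directions to be moved to the left in `F x * dG`. -/
theorem SDiffAt.mul {a : ZMod 2} (hF : SDiffAt F x) (hx : F x ∈ part 𝕜 γ a) (hG : SDiffAt G x) :
    SDiffAt (fun z => F z * G z) x :=
  sdiffAt_of_curveDeriv
    (D := ((grad F x).1 * G x + F x * (grad G x).1,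
      fun M => (grad F x).2 M * G x + sgn (a * par M) • (F x * (grad G x).2 M)))
    (fun v => (hF.curveDeriv_line v).mul (hG.curveDeriv_line v)) fun v => by
      have e (M : κ) : (v.2 M : Grassmann 𝕜 γ) * sgn (a * par M) • (F x * (grad G x).2 M)
          = F x * (v.2 M * (grad G x).2 M) := by
        rw [← mul_assoc (F x), mul_comm_of_mem_part hx (v.2 M).2, mul_smul_comm, smul_mul_assoc,
          mul_assoc]
      simp only [leftDifferential, mul_add, Finset.sum_add_distrib, smul_add, e, line_zero,
        add_mul, Finset.sum_mul, Finset.mul_sum, real_smul_mul, mul_real_smul, mul_assoc]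
      abel

theorem ptCurveDeriv_comp {κ' : Type*} {par' : κ' → ZMod 2}
    {g : Pt 𝕜 γ par → Pt 𝕜 γ par'} {y : Pt 𝕜 γ par} (ht : ∀ z, (g z).1 = z.1)
    (hg : ∀ M, SDiffAt (fun z => ((g z).2 M : Grassmann 𝕜 γ)) y) (v : Pt 𝕜 γ par) :
    PtCurveDeriv (fun s : ℝ => g (y + s • v)) (v.1, fun M =>
      ⟨leftDifferential (grad (fun z => ((g z).2 M : Grassmann 𝕜 γ)) y) v,
        leftDifferential_mem_part (hg M) (Eventually.of_forall fun z => ((g z).2 M).2) v⟩) :=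
  ⟨by simpa only [ht] using (ptCurveDeriv_line y v).time, fun M => (hg M).curveDeriv_line v⟩

/-- The chain rule: composition of a continuously superdifferentiable function with a
superdifferentiable substitution of the variables that preserves the time. -/
theorem C1At.comp {κ' : Type*} [Fintype κ'] {par' : κ' → ZMod 2} {g : Pt 𝕜 γ par' → Pt 𝕜 γ par}
    {y : Pt 𝕜 γ par'} (hF : C1At F (g y)) (ht : ∀ z, (g z).1 = z.1)
    (hg : ∀ M, SDiffAt (fun z => ((g z).2 M : Grassmann 𝕜 γ)) y) :
    SDiffAt (fun z => F (g z)) y := by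
  refine sdiffAt_of_curveDeriv
    (D := (timeDeriv F (g y) + ∑ M, (grad (fun z => ((g z).2 M : Grassmann 𝕜 γ)) y).1
        * leftDeriv F M (g y),
      fun N => ∑ M, (grad (fun z => ((g z).2 M : Grassmann 𝕜 γ)) y).2 N * leftDeriv F M (g y)))
    (ℓ := fun v => leftDifferential (grad F (g y)) (v.1, fun M =>
      ⟨leftDifferential (grad (fun z => ((g z).2 M : Grassmann 𝕜 γ)) y) v,
        leftDifferential_mem_part (hg M) (Eventually.of_forall fun z => ((g z).2 M).2) v⟩))
    (fun v => ?_) fun v => ?_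
  · have := C1At.curveDeriv (F := F) (c := fun s : ℝ => g (y + s • v))
      (by simpa only [line_zero] using hF) (ptCurveDeriv_comp ht hg v)
    simpa only [line_zero] using this
  · simp only [leftDifferential, grad, smul_add, Finset.smul_sum, add_mul, Finset.sum_mul,
      Finset.mul_sum, Finset.sum_add_distrib, real_smul_mul, mul_assoc]
    rw [add_assoc, Finset.sum_comm]

end Closure

end Differential

/-! ### Supersmooth functions and the symmetry of second derivatives -/

section Smooth

variable {𝕜 γ κ : Type*} [RCLike 𝕜] [LinearOrder γ] [Fintype κ] {par : κ → ZMod 2}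
  {U : Set (Pt 𝕜 γ par)} {F G : Pt 𝕜 γ par → Grassmann 𝕜 γ} {k : ℕ}

theorem SuperC.continuousOn (h : SuperC k U F) : ContinuousOn F U := by
  cases k with
  | zero => exact h
  | succ k => exact h.1

theorem SuperC.congr (hU : IsOpen U) (h : SuperC k U F) (e : EqOn G F U) : SuperC k U G := by
  cases k with
  | zero => exact ContinuousOn.congr h e
  | succ k =>
    obtain ⟨h0, Dt, D, h1, h2, h3⟩ := h
    exact ⟨h0.congr e, Dt, D, h1, h2, fun x hx =>
      (h3 x hx).congr (e.eventuallyEq_of_mem (hU.mem_nhds hx))⟩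

theorem SuperC.sdiffAt (h : SuperC (k + 1) U F) {x : Pt 𝕜 γ par} (hx : x ∈ U) : SDiffAt F x := by
  obtain ⟨_, Dt, D, _, _, h3⟩ := h
  exact ⟨_, h3 x hx⟩

theorem SuperC.timeDeriv (hs : EnoughGenerators γ par) (hU : IsOpen U) (h : SuperC (k + 1) U F) :
    SuperC k U (timeDeriv F) := by
  obtain ⟨_, Dt, D, h1, _, h3⟩ := h
  exact h1.congr hU fun x hx => congrArg Prod.fst ((h3 x hx).grad_eq hs)

theorem SuperC.leftDeriv (hs : EnoughGenerators γ par) (hU : IsOpen U) (h : SuperC (k + 1) U F)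
    (M : κ) : SuperC k U (leftDeriv F M) := by
  obtain ⟨_, Dt, D, _, h2, h3⟩ := h
  exact (h2 M).congr hU fun x hx => congrFun (congrArg Prod.snd ((h3 x hx).grad_eq hs)) M

theorem SuperC.c1At (hs : EnoughGenerators γ par) (hU : IsOpen U) (h : SuperC (k + 1) U F)
    {x : Pt 𝕜 γ par} (hx : x ∈ U) : C1At F x where
  sdiff := (hU.eventually_mem hx).mono fun _ hz => h.sdiffAt hz
  time := (h.timeDeriv hs hU).continuousOn.continuousAt (hU.mem_nhds hx)
  left M := (h.leftDeriv hs hU M).continuousOn.continuousAt (hU.mem_nhds hx)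

namespace IsSuperfunction

variable {a : ZMod 2}

theorem c1At (h : IsSuperfunction a U F) (hs : EnoughGenerators γ par) (hU : IsOpen U)
    {x : Pt 𝕜 γ par} (hx : x ∈ U) : C1At F x :=
  (h.smooth 1).c1At hs hU hx

theorem sdiffAt (h : IsSuperfunction a U F) {x : Pt 𝕜 γ par} (hx : x ∈ U) : SDiffAt F x :=
  (h.smooth 1).sdiffAt hx

theorem eventually_parity (h : IsSuperfunction a U F) (hU : IsOpen U) {x : Pt 𝕜 γ par}
    (hx : x ∈ U) : ∀ᶠ z in 𝓝 x, F z ∈ part 𝕜 γ a :=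
  (hU.eventually_mem hx).mono fun z hz => h.parity z hz

theorem leftDeriv (h : IsSuperfunction a U F) (hs : EnoughGenerators γ par) (hU : IsOpen U)
    (M : κ) : IsSuperfunction (a + par M) U (leftDeriv F M) where
  smooth k := (h.smooth (k + 1)).leftDeriv hs hU M
  parity _ hx := leftDeriv_mem_part hs (h.sdiffAt hx) (h.eventually_parity hU hx) M

end IsSuperfunction

/-- The second derivative of `F` at `x`: the derivative in direction `w` of the differential of `F`
in the constant direction `v`. -/
noncomputable def hessian (F : Pt 𝕜 γ par → Grassmann 𝕜 γ) (x v w : Pt 𝕜 γ par) : Grassmann 𝕜 γ :=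
  v.1 • leftDifferential (grad (timeDeriv F) x) w
    + ∑ M, (v.2 M : Grassmann 𝕜 γ) * leftDifferential (grad (leftDeriv F M) x) w

/-- The derivative of the differential of `F` along a curve, in a direction that varies along it. -/
theorem curveDeriv_leftDifferential_grad (hs : EnoughGenerators γ par) (hU : IsOpen U)
    (hF : SuperC 2 U F) {c b : ℝ → Pt 𝕜 γ par} {c' b' : Pt 𝕜 γ par} (hc : PtCurveDeriv c c')
    (hb : PtCurveDeriv b b') (h0 : c 0 ∈ U) :
    CurveDeriv (fun s => leftDifferential (grad F (c s)) (b s))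
      (hessian F (c 0) (b 0) c' + leftDifferential (grad F (c 0)) b') := by
  have h1 := (((hF.timeDeriv hs hU).c1At hs hU h0).curveDeriv hc).real_smul hb.time
  have h2 := CurveDeriv.sum (S := Finset.univ) fun M _ =>
    (hb.var M).mul (((hF.leftDeriv hs hU M).c1At hs hU h0).curveDeriv hc)
  have e := h1.add h2
  rw [Finset.sum_add_distrib] at e
  convert e using 1
  · rfl
  · simp only [hessian, leftDifferential, grad]
    abel

theorem hasFDerivAt_plane (hF : ∀ x ∈ U, C1At F x) {x v w : Pt 𝕜 γ par} {e : ℝ × ℝ}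
    (he : x + e.1 • v + e.2 • w ∈ U) (K : Finset γ) :
    HasFDerivAt (fun e : ℝ × ℝ => F (x + e.1 • v + e.2 • w) K)
      ((ContinuousLinearMap.fst ℝ ℝ ℝ).smulRight
          (leftDifferential (grad F (x + e.1 • v + e.2 • w)) v K)
        + (ContinuousLinearMap.snd ℝ ℝ ℝ).smulRight
          (leftDifferential (grad F (x + e.1 • v + e.2 • w)) w K)) e := by
  have ht : DifferentiableAt ℝ (fun e : ℝ × ℝ => (x + e.1 • v + e.2 • w).1) e := by
    change DifferentiableAt ℝ (fun e : ℝ × ℝ => x.1 + e.1 • v.1 + e.2 • w.1) e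
    fun_prop
  have hv (M : κ) (K : Finset γ) : DifferentiableAt ℝ
      (fun e : ℝ × ℝ => ((x + e.1 • v + e.2 • w).2 M : Grassmann 𝕜 γ) K) e := by
    change DifferentiableAt ℝ (fun e : ℝ × ℝ => (x.2 M : Grassmann 𝕜 γ) K
      + e.1 • (v.2 M : Grassmann 𝕜 γ) K + e.2 • (w.2 M : Grassmann 𝕜 γ) K) e
    fun_prop
  have key := (hF _ he).isLittleO (l := 𝓝 e) (c := fun e : ℝ × ℝ => x + e.1 • v + e.2 • w)
    (φ := fun e' => ‖e' - e‖)
    (tendsto_pt_iff.2 ⟨ht.continuousAt, fun M K => (hv M K).continuousAt⟩)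
    ht.isBigO_sub.norm_right (fun M K => (hv M K).isBigO_sub.norm_right) K
  rw [hasFDerivAt_iff_isLittleO]
  refine key.of_norm_right.congr_left fun e' => ?_
  have h1 : x + e'.1 • v + e'.2 • w - (x + e.1 • v + e.2 • w)
      = (e'.1 - e.1) • v + (e'.2 - e.2) • w := by
    rw [sub_smul, sub_smul]
    abel
  rw [h1, leftDifferential_add, leftDifferential_smul, leftDifferential_smul]
  rfl

/-- The symmetry of second derivatives, reduced for each coefficient to the restriction of the
function to a plane. -/
theorem hessian_symm (hs : EnoughGenerators γ par) (hU : IsOpen U) (hF : SuperC 2 U F)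
    {x : Pt 𝕜 γ par} (hx : x ∈ U) (v w : Pt 𝕜 γ par) : hessian F x v w = hessian F x w v := by
  funext K
  set p : ℝ × ℝ → Pt 𝕜 γ par := fun e => x + e.1 • v + e.2 • w with hp
  have hp0 : p 0 = x := by simp [hp]
  have hx0 : x + (0 : ℝ × ℝ).1 • v + (0 : ℝ × ℝ).2 • w ∈ U := by
    rwa [show x + (0 : ℝ × ℝ).1 • v + (0 : ℝ × ℝ).2 • w = x from hp0]
  have hpc : Tendsto p (𝓝 0) (𝓝 x) := by
    refine tendsto_pt_iff.2 ⟨?_, fun M K => ?_⟩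
    · have : ContinuousAt (fun e : ℝ × ℝ => x.1 + e.1 • v.1 + e.2 • w.1) 0 := by fun_prop
      simpa [ContinuousAt, hp] using this
    · have : ContinuousAt (fun e : ℝ × ℝ => (x.2 M : Grassmann 𝕜 γ) K
        + e.1 • (v.2 M : Grassmann 𝕜 γ) K + e.2 • (w.2 M : Grassmann 𝕜 γ) K) 0 := by fun_prop
      have := this.tendsto
      simp only [Prod.fst_zero, Prod.snd_zero, zero_smul, add_zero] at this
      exact this
  set d : Pt 𝕜 γ par → ℝ × ℝ → 𝕜 := fun u e => leftDifferential (grad F (p e)) u K with hd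
  have hdd (u : Pt 𝕜 γ par) : DifferentiableAt ℝ (d u) 0 := by
    have h1 : DifferentiableAt ℝ (fun e => timeDeriv F (p e) K) 0 :=
      (hasFDerivAt_plane (fun z hz => (hF.timeDeriv hs hU).c1At hs hU hz) hx0 K).differentiableAt
    have h2 (M : κ) (J : Finset γ) : DifferentiableAt ℝ (fun e => leftDeriv F M (p e) J) 0 :=
      (hasFDerivAt_plane (fun z hz => (hF.leftDeriv hs hU M).c1At hs hU hz) hx0 J).differentiableAt
    simp only [hd, leftDifferential_coeff]
    exact (h1.const_smul u.1).fun_add (DifferentiableAt.fun_sum fun M _ =>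
      DifferentiableAt.fun_sum fun I _ => ((h2 M _).const_mul _).const_mul _)
  set f' : ℝ × ℝ → ℝ × ℝ →L[ℝ] 𝕜 := fun e =>
    (ContinuousLinearMap.fst ℝ ℝ ℝ).smulRight (d v e)
      + (ContinuousLinearMap.snd ℝ ℝ ℝ).smulRight (d w e) with hf'
  have hf'd : DifferentiableAt ℝ f' 0 := by
    have hv := hdd v
    have hw := hdd w
    exact ((ContinuousLinearMap.smulRightL ℝ (ℝ × ℝ) 𝕜
        (ContinuousLinearMap.fst ℝ ℝ ℝ)).differentiableAt.comp 0 hv).add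
      ((ContinuousLinearMap.smulRightL ℝ (ℝ × ℝ) 𝕜
        (ContinuousLinearMap.snd ℝ ℝ ℝ)).differentiableAt.comp 0 hw)
  have hsymm := second_derivative_symmetric_of_eventually_of_real
    (f := fun e => F (p e) K) (f' := f') (x := 0)
    ((hpc.eventually (hU.mem_nhds hx)).mono fun e he =>
      hasFDerivAt_plane (fun z hz => hF.c1At hs hU hz) he K)
    hf'd.hasFDerivAt (1, 0) (0, 1)
  have hline (u : Pt 𝕜 γ par) (q : Pt 𝕜 γ par) := curveDeriv_leftDifferential_grad hs hU hF
    (ptCurveDeriv_line x q) (b := fun _ => u) (b' := 0)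
    ⟨hasDerivAt_const _ _, fun M => CurveDeriv.const _⟩ (by rwa [line_zero]) K
  have h0 : leftDifferential (grad F x) (0 : Pt 𝕜 γ par) = 0 := by
    simp [leftDifferential]
  simp only [line_zero, h0, add_zero] at hline
  have hev (e i : ℝ × ℝ) : HasDerivAt (fun s : ℝ => f' (s • e) i) (fderiv ℝ f' 0 e i) 0 := by
    have hl : HasDerivAt (fun s : ℝ => s • e) e 0 := by
      simpa using (hasDerivAt_id (0 : ℝ)).smul_const e
    have h1 : HasFDerivAt f' (fderiv ℝ f' 0) ((0 : ℝ) • e) := by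
      rw [zero_smul]
      exact hf'd.hasFDerivAt
    have h2 := h1.comp_hasDerivAt (0 : ℝ) hl
    exact (ContinuousLinearMap.apply ℝ 𝕜 i).hasFDerivAt.comp_hasDerivAt (0 : ℝ) h2
  have e1 : hessian F x w v K = fderiv ℝ f' 0 (1, 0) (0, 1) := by
    refine (hline w v).unique ((hev (1, 0) (0, 1)).congr_of_eventuallyEq
      (Eventually.of_forall fun s => ?_))
    simp [hf', hd, hp]
  have e2 : hessian F x v w K = fderiv ℝ f' 0 (0, 1) (1, 0) := by
    refine (hline v w).unique ((hev (0, 1) (1, 0)).congr_of_eventuallyEq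
      (Eventually.of_forall fun s => ?_))
    simp [hf', hd, hp]
  rw [e1, e2, hsymm]

end Smooth

/-! ### Symmetries of the Lagrangian -/

section SumDirections

variable {𝕜 γ α β : Type*} [RCLike 𝕜] [LinearOrder γ] [Fintype α] [Fintype β] [DecidableEq α]
  [DecidableEq β] {p : α → ZMod 2} {q : β → ZMod 2}

theorem EnoughGenerators.sumElim {γ α β : Type*} {p : α → ZMod 2} {q : β → ZMod 2}
    (hp : EnoughGenerators γ p) (hq : EnoughGenerators γ q) :
    EnoughGenerators γ (Sum.elim p q) := by
  rcases hp with h | hp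
  · exact Or.inl h
  · exact hq.imp_right fun hq => Sum.rec hp hq

/-- The direction in which only the variable `.inl A` is varied, by `k`. -/
noncomputable def dirInl (q : β → ZMod 2) (A : α) (k : part 𝕜 γ (p A)) :
    Pt 𝕜 γ (Sum.elim p q) :=
  (0, fun
    | .inl B => (Pi.single A k : Vars 𝕜 γ p) B
    | .inr _ => 0)

/-- The direction in which only the variable `.inr A` is varied, by `k`. -/
noncomputable def dirInr (p : α → ZMod 2) (A : β) (k : part 𝕜 γ (q A)) :
    Pt 𝕜 γ (Sum.elim p q) :=
  (0, fun
    | .inl _ => 0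
    | .inr B => (Pi.single A k : Vars 𝕜 γ q) B)

theorem sum_single_mul (A : α) (k : part 𝕜 γ (p A)) (f : α → Grassmann 𝕜 γ) :
    ∑ B, ((Pi.single A k : Vars 𝕜 γ p) B : Grassmann 𝕜 γ) * f B = k * f A := by
  rw [Finset.sum_eq_single A]
  · simp
  · intro B _ hB
    simp [Pi.single_eq_of_ne hB]
  · simp

theorem leftDifferential_dirInl (D : Grassmann 𝕜 γ × (α ⊕ β → Grassmann 𝕜 γ)) (A : α)
    (k : part 𝕜 γ (p A)) : leftDifferential D (dirInl q A k) = k * D.2 (.inl A) := by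
  simp [leftDifferential, dirInl, Fintype.sum_sum_type, sum_single_mul]

theorem leftDifferential_dirInr (D : Grassmann 𝕜 γ × (α ⊕ β → Grassmann 𝕜 γ)) (A : β)
    (k : part 𝕜 γ (q A)) : leftDifferential D (dirInr p A k) = k * D.2 (.inr A) := by
  simp [leftDifferential, dirInr, Fintype.sum_sum_type, sum_single_mul]

theorem hessian_dirInr (F : Pt 𝕜 γ (Sum.elim p q) → Grassmann 𝕜 γ)
    (x w : Pt 𝕜 γ (Sum.elim p q)) (A : β) (k : part 𝕜 γ (q A)) :
    hessian F x (dirInr p A k) w = k * leftDifferential (grad (leftDeriv F (.inr A)) x) w := by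
  simp [hessian, dirInr, Fintype.sum_sum_type, sum_single_mul]

end SumDirections

section Lagrangian

variable {𝕜 γ ι : Type*} [RCLike 𝕜] [LinearOrder γ] [Fintype ι] [DecidableEq ι] {par : ι → ZMod 2}

/-- The velocity `(1, q̇, a)` of a trajectory with accelerations `a` in the space of positions and
velocities. -/
def flowDirection (x : VelPt 𝕜 γ par) (a : Vars 𝕜 γ par) : VelPt 𝕜 γ par :=
  (1, fun
    | .inl A => x.2 (.inr A)
    | .inr A => a A)

theorem totalDeriv_eq_leftDifferential (F : VelPt 𝕜 γ par → Grassmann 𝕜 γ) (x : VelPt 𝕜 γ par)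
    (a : Vars 𝕜 γ par) :
    totalDeriv F x a = leftDifferential (grad F x) (flowDirection x a) := by
  simp only [totalDeriv, leftDifferential, Fintype.sum_sum_type, grad, flowDirection, one_smul,
    add_assoc]

/-- The variation `(0, δq, dδq/dt)` of the positions and velocities under a symmetry. -/
noncomputable def symmetryDirection (δq : ι → VelPt 𝕜 γ par → Grassmann 𝕜 γ) (x : VelPt 𝕜 γ par)
    (a : Vars 𝕜 γ par) : VelPt 𝕜 γ par :=
  (0, fun
    | .inl A => homog (par A) (δq A x)
    | .inr A => homog (par A) (totalDeriv (δq A) x a))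

variable {U : Set (VelPt 𝕜 γ par)} {L : VelPt 𝕜 γ par → Grassmann 𝕜 γ}
  {δq : ι → VelPt 𝕜 γ par → Grassmann 𝕜 γ} {δK : VelPt 𝕜 γ par → Grassmann 𝕜 γ}

theorem IsSuperfunction.totalDeriv_mem_part {F : VelPt 𝕜 γ par → Grassmann 𝕜 γ} {d : ZMod 2}
    (hF : IsSuperfunction d U F) (hU : IsOpen U) {x : VelPt 𝕜 γ par} (hx : x ∈ U)
    (a : Vars 𝕜 γ par) : totalDeriv F x a ∈ part 𝕜 γ d := by
  rw [totalDeriv_eq_leftDifferential]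
  exact leftDifferential_mem_part (hF.sdiffAt hx) (hF.eventually_parity hU hx) _

theorem variation_eq_leftDifferential (hU : IsOpen U) (hq : ∀ A, IsSuperfunction (par A) U (δq A))
    {x : VelPt 𝕜 γ par} (hx : x ∈ U) (F : VelPt 𝕜 γ par → Grassmann 𝕜 γ) (a : Vars 𝕜 γ par) :
    variation δq F x a = leftDifferential (grad F x) (symmetryDirection δq x a) := by
  have h1 (A : ι) : (homog (par A) (δq A x) : Grassmann 𝕜 γ) = δq A x :=
    homog_coe ((hq A).parity x hx)
  have h2 (A : ι) : (homog (par A) (totalDeriv (δq A) x a) : Grassmann 𝕜 γ)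
      = totalDeriv (δq A) x a := homog_coe ((hq A).totalDeriv_mem_part hU hx a)
  simp only [variation, leftDifferential, Fintype.sum_sum_type, grad, symmetryDirection, zero_smul,
    zero_add, h1, h2]

theorem totalDeriv_single (F : VelPt 𝕜 γ par → Grassmann 𝕜 γ) (x : VelPt 𝕜 γ par) (A : ι)
    (k : part 𝕜 γ (par A)) :
    totalDeriv F x (Pi.single A k) = totalDeriv F x 0 + k * leftDeriv F (.inr A) x := by
  rw [totalDeriv, sum_single_mul, totalDeriv]
  simp

/-- The part of the Noether identity `δL = dδK/dt` linear in the accelerations. -/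
theorem IsLagrangianSymmetry.sum_leftDeriv_mul_momentum (hsym : IsLagrangianSymmetry U L δq δK)
    (hγ : EnoughGenerators γ par) {x : VelPt 𝕜 γ par} (hx : x ∈ U) (A : ι) :
    ∑ B, leftDeriv (δq B) (.inr A) x * momentum L B x = leftDeriv δK (.inr A) x := by
  refine eq_of_part_mul_eq (hγ.apply A) fun k => ?_
  have h0 := hsym.variation_eq x hx 0
  have h1 := hsym.variation_eq x hx (Pi.single A k)
  simp only [variation, totalDeriv_single, add_mul, Finset.sum_add_distrib] at h0 h1
  rw [← add_assoc, h0] at h1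
  rw [Finset.mul_sum, ← add_left_cancel h1]
  exact Finset.sum_congr rfl fun B _ => (mul_assoc _ _ _).symm

/-- `δp_A` is the variation of the momentum `p_A` up to the Euler-Lagrange equations.  The Noether
identity is differentiated in the direction `q̇^A`; the total time derivative of its part linear in
the accelerations is then subtracted. -/
theorem IsLagrangianSymmetry.deltaP_eq (hsym : IsLagrangianSymmetry U L δq δK)
    (hγ : EnoughGenerators γ par) (hU : IsOpen U) (hL : IsSuperfunction 0 U L)
    {x : VelPt 𝕜 γ par} (hx : x ∈ U) (a : Vars 𝕜 γ par) (A : ι) :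
    deltaP L δq δK A x = variation δq (momentum L A) x a
      - ∑ B, leftDeriv (δq B) (.inr A) x * eulerLagrange L B x a := by
  have hs := hγ.sumElim hγ
  have hq := hsym.superfunction_q
  -- derivatives of total time derivatives in the direction `q̇^A`
  have htot {F : VelPt 𝕜 γ par → Grassmann 𝕜 γ} {d : ZMod 2} (hF : IsSuperfunction d U F)
      (k : part 𝕜 γ (par A)) :
      CurveDeriv (fun s : ℝ => totalDeriv F (x + s • dirInr par A k) a)
        (k * (totalDeriv (leftDeriv F (.inr A)) x a + leftDeriv F (.inl A) x)) := by
    have hb : PtCurveDeriv (fun s : ℝ => flowDirection (x + s • dirInr par A k) a)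
        (dirInl par A k) := by
      refine ⟨hasDerivAt_const _ _, ?_⟩
      rintro (B | B)
      · exact (ptCurveDeriv_line x (dirInr par A k)).var (.inr B)
      · exact CurveDeriv.const (a B : Grassmann 𝕜 γ)
    have h1 := curveDeriv_leftDifferential_grad hs hU (hF.smooth 2)
      (ptCurveDeriv_line x (dirInr par A k)) hb (by rwa [line_zero])
    simp only [line_zero, ← totalDeriv_eq_leftDifferential] at h1
    rw [hessian_symm hs hU (hF.smooth 2) hx, hessian_dirInr, ← totalDeriv_eq_leftDifferential,
      leftDifferential_dirInl, ← mul_add] at h1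
    exact h1
  have hline (k : part 𝕜 γ (par A)) := tendsto_line x (dirInr par A k)
  -- the Noether identity, differentiated in the direction `q̇^A`
  have hI : variation δq (momentum L A) x a
      + ∑ B, leftDeriv (δq B) (.inr A) x * leftDeriv L (.inl B) x
      + ∑ B, (totalDeriv (leftDeriv (δq B) (.inr A)) x a + leftDeriv (δq B) (.inl A) x)
          * momentum L B x
      = totalDeriv (leftDeriv δK (.inr A)) x a + leftDeriv δK (.inl A) x := by
    refine eq_of_part_mul_eq (hγ.apply A) fun k => ?_
    have hUe : ∀ᶠ s : ℝ in 𝓝 0, x + s • dirInr par A k ∈ U :=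
      (hline k).eventually (hU.eventually_mem hx)
    have hdq (B : ι) := ((hq B).sdiffAt hx).curveDeriv_line (dirInr par A k)
    simp only [leftDifferential_dirInr] at hdq
    -- the derivative of the direction `(0, δq, dδq/dt)` along the line
    set v' : VelPt 𝕜 γ par := (0, fun
      | .inl B => homog (par B) ((k : Grassmann 𝕜 γ) * leftDeriv (δq B) (.inr A) x)
      | .inr B => homog (par B)
          ((k : Grassmann 𝕜 γ) * (totalDeriv (leftDeriv (δq B) (.inr A)) x a
            + leftDeriv (δq B) (.inl A) x))) with hv'
    have hv1 (B : ι) : (homog (par B) ((k : Grassmann 𝕜 γ) * leftDeriv (δq B) (.inr A) x)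
          : Grassmann 𝕜 γ)
        = k * leftDeriv (δq B) (.inr A) x :=
      homog_coe ((hdq B).mem_part (hUe.mono fun s hs => (hq B).parity _ hs))
    have hv2 (B : ι) : (homog (par B)
        ((k : Grassmann 𝕜 γ) * (totalDeriv (leftDeriv (δq B) (.inr A)) x a
          + leftDeriv (δq B) (.inl A) x))
          : Grassmann 𝕜 γ)
        = k * (totalDeriv (leftDeriv (δq B) (.inr A)) x a + leftDeriv (δq B) (.inl A) x) :=
      homog_coe ((htot (hq B) k).mem_part
        (hUe.mono fun s hs => (hq B).totalDeriv_mem_part hU hs a))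
    have hb : PtCurveDeriv (fun s : ℝ =>
        symmetryDirection δq (x + s • dirInr par A k) a) v' := by
      refine ⟨hasDerivAt_const _ _, ?_⟩
      rintro (B | B)
      · change CurveDeriv (fun s : ℝ => (homog (par B) (δq B (x + s • dirInr par A k))
          : Grassmann 𝕜 γ)) (homog (par B) ((k : Grassmann 𝕜 γ) * leftDeriv (δq B) (.inr A) x))
        rw [hv1]
        exact (hdq B).congr (hUe.mono fun s hs => homog_coe ((hq B).parity _ hs))
      · change CurveDeriv (fun s : ℝ => (homog (par B)
          (totalDeriv (δq B) (x + s • dirInr par A k) a) : Grassmann 𝕜 γ)) (homog (par B)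
          ((k : Grassmann 𝕜 γ) * (totalDeriv (leftDeriv (δq B) (.inr A)) x a
            + leftDeriv (δq B) (.inl A) x)))
        rw [hv2]
        exact (htot (hq B) k).congr (hUe.mono fun s hs =>
          homog_coe ((hq B).totalDeriv_mem_part hU hs a))
    have h1 := curveDeriv_leftDifferential_grad hs hU (hL.smooth 2)
      (ptCurveDeriv_line x (dirInr par A k)) hb (by rwa [line_zero])
    simp only [line_zero] at h1
    have h2 := (htot hsym.superfunction_K k).congr (hUe.mono fun s hs =>
      ((variation_eq_leftDifferential hU hq hs L a).symm.trans (hsym.variation_eq _ hs a)))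
    rw [← h1.unique h2, hessian_symm hs hU (hL.smooth 2) hx, hessian_dirInr,
      ← variation_eq_leftDifferential hU hq hx]
    simp only [leftDifferential, hv', Fintype.sum_sum_type, hv1, hv2, grad]
    rw [add_assoc, mul_add, mul_add, Finset.mul_sum, Finset.mul_sum, zero_smul, zero_add]
    simp only [mul_assoc]
    rfl
  -- the total time derivative of the part of the Noether identity linear in the accelerations
  have hII : ∑ B, (totalDeriv (leftDeriv (δq B) (.inr A)) x a * momentum L B x
      + leftDeriv (δq B) (.inr A) x * totalDeriv (momentum L B) x a)
      = totalDeriv (leftDeriv δK (.inr A)) x a := by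
    have h1 := CurveDeriv.sum (S := Finset.univ) fun B _ =>
      ((((hq B).leftDeriv hs hU (.inr A)).sdiffAt hx).curveDeriv_line (flowDirection x a)).mul
        (((hL.leftDeriv hs hU (.inr B)).sdiffAt hx).curveDeriv_line (flowDirection x a))
    have h2 := (((hsym.superfunction_K.leftDeriv hs hU (.inr A)).sdiffAt hx).curveDeriv_line
      (flowDirection x a)).congr ((((tendsto_line x (flowDirection x a)).eventually
        (hU.eventually_mem hx))).mono fun s hs => hsym.sum_leftDeriv_mul_momentum hγ hs A)
    simp only [totalDeriv_eq_leftDifferential]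
    simpa only [line_zero, momentum] using h1.unique h2
  simp only [deltaP, eulerLagrange, mul_sub, Finset.sum_sub_distrib]
  simp only [add_mul, Finset.sum_add_distrib] at hI hII
  rw [← hII] at hI
  rw [← sub_eq_zero] at hI ⊢
  rw [← neg_eq_zero, ← hI]
  abel

end Lagrangian

/-! ### The energy and its dependence on the free velocities -/

section Reduction

variable {𝕜 γ ι : Type*} [RCLike 𝕜] [LinearOrder γ] [Fintype ι] [DecidableEq ι] {par : ι → ZMod 2}
  {P R : Finset ι}

theorem EnoughGenerators.comp {α β : Type*} {p : α → ZMod 2} (hp : EnoughGenerators γ p)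
    (e : β → α) : EnoughGenerators γ fun b => p (e b) :=
  hp.imp_right fun h b => h (e b)

theorem toRed_line (y v : PhasePt 𝕜 γ par) (s : ℝ) :
    toRed P (y + s • v) = toRed P y + s • toRed P v := by
  refine Prod.ext rfl (funext ?_)
  rintro (A | a) <;> rfl

theorem hatToRed_line (w v : HatPt 𝕜 γ par P R) (s : ℝ) :
    hatToRed (w + s • v) = hatToRed w + s • hatToRed v := by
  refine Prod.ext rfl (funext ?_)
  rintro (A | a) <;> rfl

theorem continuous_toRed : Continuous (toRed P : PhasePt 𝕜 γ par → RedPt 𝕜 γ par P) := by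
  refine continuous_fst.prodMk (continuous_pi ?_)
  rintro (A | a)
  · exact (continuous_apply (Sum.inl A)).comp continuous_snd
  · exact (continuous_apply (Sum.inr a.1)).comp continuous_snd

/-- The point over `r` with the same free velocities as `w`. -/
def liftHat (w : HatPt 𝕜 γ par P R) (r : RedPt 𝕜 γ par P) : HatPt 𝕜 γ par P R :=
  (r.1, fun
    | .inl A => r.2 (.inl A)
    | .inr (.inl a) => r.2 (.inr a)
    | .inr (.inr m) => w.2 (.inr (.inr m)))

theorem hatToRed_liftHat (w : HatPt 𝕜 γ par P R) (r : RedPt 𝕜 γ par P) :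
    hatToRed (liftHat w r) = r := by
  refine Prod.ext rfl (funext ?_)
  rintro (A | a) <;> rfl

theorem liftHat_hatToRed (w : HatPt 𝕜 γ par P R) : liftHat w (hatToRed w) = w := by
  refine Prod.ext rfl (funext ?_)
  rintro (A | a | m) <;> rfl

theorem continuous_liftHat (w : HatPt 𝕜 γ par P R) : Continuous (liftHat w) := by
  refine continuous_fst.prodMk (continuous_pi ?_)
  rintro (A | a | m)
  · exact (continuous_apply (Sum.inl A)).comp continuous_snd
  · exact (continuous_apply (Sum.inr a)).comp continuous_snd
  · exact continuous_const

theorem isOpen_hatToRed_image {W : Set (HatPt 𝕜 γ par P R)} (hW : IsOpen W) :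
    IsOpen (hatToRed '' W) := by
  rw [isOpen_iff_mem_nhds]
  rintro _ ⟨w, hw, rfl⟩
  have h : ∀ᶠ r in 𝓝 (hatToRed w), liftHat w r ∈ W :=
    (continuous_liftHat w).continuousAt.eventually
      (by rw [liftHat_hatToRed]; exact hW.mem_nhds hw)
  exact h.mono fun r hr => ⟨_, hr, hatToRed_liftHat w r⟩

/-- The positions and velocities at the point `w`: the velocities `q̇^m̂` are variables, the others
are given by `h`. -/
noncomputable def velOfHat (h : {A // A ∉ R} → HatPt 𝕜 γ par P R → Grassmann 𝕜 γ)
    (w : HatPt 𝕜 γ par P R) : VelPt 𝕜 γ par :=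
  (w.1, fun
    | .inl A => w.2 (.inl A)
    | .inr A => if hA : A ∈ R then w.2 (.inr (.inr ⟨A, hA⟩)) else homog (par A) (h ⟨A, hA⟩ w))

theorem velOfHat_inr_of_mem (h : {A // A ∉ R} → HatPt 𝕜 γ par P R → Grassmann 𝕜 γ)
    (w : HatPt 𝕜 γ par P R) {A : ι} (hA : A ∈ R) :
    ((velOfHat h w).2 (.inr A) : Grassmann 𝕜 γ) = w.2 (.inr (.inr ⟨A, hA⟩)) :=
  congrArg Subtype.val (dif_pos hA)

theorem velOfHat_inr_of_notMem (h : {A // A ∉ R} → HatPt 𝕜 γ par P R → Grassmann 𝕜 γ)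
    (w : HatPt 𝕜 γ par P R) {A : ι} (hA : A ∉ R) :
    ((velOfHat h w).2 (.inr A) : Grassmann 𝕜 γ) = homog (par A) (h ⟨A, hA⟩ w) :=
  congrArg Subtype.val (dif_neg hA)

/-- All the momenta on the primary constraint surface, as functions of the independent ones. -/
noncomputable def surfaceMomentum (f : {A // A ∈ P} → RedPt 𝕜 γ par P → Grassmann 𝕜 γ) (A : ι)
    (r : RedPt 𝕜 γ par P) : Grassmann 𝕜 γ :=
  if hA : A ∈ P then f ⟨A, hA⟩ r else r.2 (.inr ⟨A, hA⟩)

theorem surfaceMomentum_toRed (f : {A // A ∈ P} → RedPt 𝕜 γ par P → Grassmann 𝕜 γ) (A : ι)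
    (y : PhasePt 𝕜 γ par) : surfaceMomentum f A (toRed P y)
      = y.2 (.inr A) - if hA : A ∈ P then constraintFn f ⟨A, hA⟩ y else 0 := by
  unfold surfaceMomentum constraintFn
  split_ifs
  · exact (sub_sub_cancel _ _).symm
  · exact (sub_zero _).symm

/-- The energy `q̇^A p_A - L` as a function of `(t, q, p_a, q̇^m̂)`. -/
noncomputable def energy (L : VelPt 𝕜 γ par → Grassmann 𝕜 γ)
    (h : {A // A ∉ R} → HatPt 𝕜 γ par P R → Grassmann 𝕜 γ)
    (f : {A // A ∈ P} → RedPt 𝕜 γ par P → Grassmann 𝕜 γ) (w : HatPt 𝕜 γ par P R) :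
    Grassmann 𝕜 γ :=
  ∑ A, ((velOfHat h w).2 (.inr A) : Grassmann 𝕜 γ) * surfaceMomentum f A (hatToRed w)
    - L (velOfHat h w)

variable {U : Set (VelPt 𝕜 γ par)} {L : VelPt 𝕜 γ par → Grassmann 𝕜 γ}
  {W : Set (HatPt 𝕜 γ par P R)} {h : {A // A ∉ R} → HatPt 𝕜 γ par P R → Grassmann 𝕜 γ}
  {f : {A // A ∈ P} → RedPt 𝕜 γ par P → Grassmann 𝕜 γ}

/-- The variations of the velocities cancel in the variation of the energy, because
`p_A = ∂L/∂q̇^A`. -/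
theorem curveDeriv_energy (hγ : EnoughGenerators γ par) (hU : IsOpen U)
    (hL : IsSuperfunction 0 U L) {c : ℝ → VelPt 𝕜 γ par} {v : VelPt 𝕜 γ par}
    (hc : PtCurveDeriv c v) (h0 : c 0 ∈ U) {p : ι → ℝ → Grassmann 𝕜 γ}
    {p' : ι → Grassmann 𝕜 γ} (hp : ∀ A, CurveDeriv (p A) (p' A))
    (hp0 : ∀ A, p A 0 = momentum L A (c 0)) :
    CurveDeriv (fun s => ∑ A, ((c s).2 (.inr A) : Grassmann 𝕜 γ) * p A s - L (c s))
      (∑ A, ((c 0).2 (.inr A) : Grassmann 𝕜 γ) * p' A - v.1 • timeDeriv L (c 0)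
        - ∑ A, (v.2 (.inl A) : Grassmann 𝕜 γ) * leftDeriv L (.inl A) (c 0)) := by
  have h1 := (CurveDeriv.sum (S := Finset.univ) fun A _ => (hc.var (.inr A)).mul (hp A)).sub
    ((hL.c1At (hγ.sumElim hγ) hU h0).curveDeriv hc)
  convert h1 using 1
  simp only [leftDifferential, Fintype.sum_sum_type, grad, Finset.sum_add_distrib, hp0, momentum]
  abel

namespace IsPrimaryReduction

theorem velOfHat_mem (hred : IsPrimaryReduction U L W h f) {w : HatPt 𝕜 γ par P R} (hw : w ∈ W) :
    velOfHat h w ∈ U ∧ LiesOver L (velOfHat h w) (hatToRed w) := by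
  have := (hred.correspondence (velOfHat h w) w).2 ⟨hw, rfl, fun A => rfl, fun b => ?_, fun m => ?_⟩
  · exact ⟨this.1, this.2.1⟩
  · rw [velOfHat_inr_of_notMem h w b.2]
    exact homog_coe ((hred.superfunction_h b).parity w hw)
  · exact velOfHat_inr_of_mem h w m.2

theorem exists_velOfHat_eq (hred : IsPrimaryReduction U L W h f) {x : VelPt 𝕜 γ par}
    {r : RedPt 𝕜 γ par P} (hx : x ∈ U) (hr : LiesOver L x r) :
    ∃ w ∈ W, hatToRed w = r ∧ velOfHat h w = x := by
  let w : HatPt 𝕜 γ par P R := (r.1, fun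
    | .inl A => r.2 (.inl A)
    | .inr (.inl a) => r.2 (.inr a)
    | .inr (.inr m) => x.2 (.inr m.1))
  have hwr : hatToRed w = r := by
    refine Prod.ext rfl (funext ?_)
    rintro (A | a) <;> rfl
  obtain ⟨hw, h1, h2, h3, h4⟩ := (hred.correspondence x w).1 ⟨hx, hwr.symm ▸ hr, fun m => rfl⟩
  refine ⟨w, hw, hwr, Prod.ext h1.symm (funext ?_)⟩
  rintro (A | A)
  · exact Subtype.ext (h2 A).symm
  · refine Subtype.ext ?_
    by_cases hA : A ∈ R
    · exact (velOfHat_inr_of_mem h w hA).trans (h4 ⟨A, hA⟩).symm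
    · rw [velOfHat_inr_of_notMem h w hA]
      refine Eq.trans ?_ (h3 ⟨A, hA⟩).symm
      exact homog_coe ((hred.superfunction_h ⟨A, hA⟩).parity w hw)

theorem surfaceMomentum_eq (hred : IsPrimaryReduction U L W h f) {x : VelPt 𝕜 γ par}
    {r : RedPt 𝕜 γ par P} (hx : x ∈ U) (hr : LiesOver L x r) (A : ι) :
    surfaceMomentum f A r = momentum L A x := by
  unfold surfaceMomentum
  split_ifs with hA
  · exact (hred.constraint x hx r hr ⟨A, hA⟩).symm
  · exact (hr.2.2 ⟨A, hA⟩).symm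

theorem sdiffAt_velOfHat (hred : IsPrimaryReduction U L W h f) (hγ : EnoughGenerators γ par)
    {κ : Type*} [Fintype κ] {par' : κ → ZMod 2} {g : Pt 𝕜 γ par' → HatPt 𝕜 γ par P R}
    {y : Pt 𝕜 γ par'} (hg : ContinuousAt g y) (ht : ∀ z, (g z).1 = z.1)
    (hd : ∀ M, SDiffAt (fun z => ((g z).2 M : Grassmann 𝕜 γ)) y) (hy : g y ∈ W)
    (M : ι ⊕ ι) : SDiffAt (fun z => ((velOfHat h (g z)).2 M : Grassmann 𝕜 γ)) y := by
  rcases M with A | A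
  · exact hd (.inl A)
  · by_cases hA : A ∈ R
    · simp only [velOfHat_inr_of_mem h _ hA]
      exact hd (.inr (.inr ⟨A, hA⟩))
    · simp only [velOfHat_inr_of_notMem h _ hA]
      have hs : EnoughGenerators γ (Sum.elim par (Sum.elim (fun a : {A // A ∉ P} => par a)
          fun m : {A // A ∈ R} => par m)) :=
        hγ.sumElim ((hγ.comp _).sumElim (hγ.comp _))
      exact (((hred.superfunction_h ⟨A, hA⟩).c1At hs hred.isOpen hy).comp ht hd).congr
        ((hg.eventually (hred.isOpen.eventually_mem hy)).mono fun z hz =>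
          homog_coe ((hred.superfunction_h ⟨A, hA⟩).parity _ hz))

/-- The derivative of the energy in the direction of the free velocities vanishes. -/
theorem curveDeriv_energy_vertical (hred : IsPrimaryReduction U L W h f)
    (hγ : EnoughGenerators γ par) (hU : IsOpen U) (hL : IsSuperfunction 0 U L)
    {w v : HatPt 𝕜 γ par P R} (hw : w ∈ W) (hv : hatToRed v = 0) :
    CurveDeriv (fun s : ℝ => energy L h f (w + s • v)) 0 := by
  have hc := ptCurveDeriv_comp (g := velOfHat h) (fun z => rfl)
    (hred.sdiffAt_velOfHat hγ (g := id) continuousAt_id (fun z => rfl)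
      (fun M => sdiffAt_coord M w) hw) v
  have hq (A : ι) : leftDifferential
      (grad (fun z => ((velOfHat h z).2 (.inl A) : Grassmann 𝕜 γ)) w) v = 0 := by
    refine (leftDifferential_grad_coord (.inl A) w v).trans ?_
    have : (hatToRed v).2 (.inl A) = 0 := by rw [hv]; rfl
    exact congrArg Subtype.val this
  have ht : v.1 = 0 := congrArg Prod.fst hv
  have h1 := curveDeriv_energy hγ hU hL hc
    (by simpa only [line_zero] using (hred.velOfHat_mem hw).1)
    (p := fun A _ => surfaceMomentum f A (hatToRed w)) (fun A => CurveDeriv.const _)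
    (fun A => by
      simpa only [line_zero] using
        hred.surfaceMomentum_eq (hred.velOfHat_mem hw).1 (hred.velOfHat_mem hw).2 A)
  simp only [hq, ht, mul_zero, zero_mul, zero_smul, Finset.sum_const_zero, sub_zero] at h1
  refine h1.congr (Eventually.of_forall fun s => ?_)
  simp only [energy, hatToRed_line, hv, smul_zero, add_zero]

/-- The energy does not depend on the free velocities, since their range is connected. -/
theorem energy_eq (hred : IsPrimaryReduction U L W h f)
    (hγ : EnoughGenerators γ par) (hU : IsOpen U) (hL : IsSuperfunction 0 U L)
    {w w' : HatPt 𝕜 γ par P R} (hw : w ∈ W) (hw' : w' ∈ W) (e : hatToRed w = hatToRed w') :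
    energy L h f w = energy L h f w' := by
  refine (hred.fibre_connected (hatToRed w)).induction₂
    (fun w w' => energy L h f w = energy L h f w') ?_ (fun _ _ _ _ _ _ => Eq.trans)
    (fun _ _ _ _ => Eq.symm) ⟨hw, rfl⟩ ⟨hw', e.symm⟩
  rintro z ⟨hz, hzr⟩
  obtain ⟨N, ⟨hN1, hN2⟩, hN3⟩ :=
    (LocallyConvexSpace.convex_basis (𝕜 := ℝ) z).mem_iff.1 (hred.isOpen.mem_nhds hz)
  filter_upwards [mem_nhdsWithin_of_mem_nhds hN1, self_mem_nhdsWithin] with z' hz' hzr'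
  funext K
  set v := z' - z with hv
  have hvert : hatToRed v = 0 := by
    have h1 := hatToRed_line z v 1
    rw [one_smul, one_smul, hv, add_sub_cancel, hzr'.2, hzr] at h1
    exact left_eq_add.1 h1
  -- on a convex neighbourhood, the energy is constant along segments within the fibre
  have hd : ∀ r ∈ Icc (0 : ℝ) 1, HasDerivWithinAt (fun s : ℝ => energy L h f (z + s • v) K) 0
      (Icc 0 1) r := fun r hr => by
    exact (hasDerivAt_line (hred.curveDeriv_energy_vertical hγ hU hL
      (hN3 (hN2.add_smul_sub_mem (mem_of_mem_nhds hN1) hz' hr)) hvert) K).hasDerivWithinAt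
  have hb := (convex_Icc (0 : ℝ) 1).norm_image_sub_le_of_norm_hasDerivWithin_le (C := 0) hd
    (fun r _ => norm_zero.le) (left_mem_Icc.2 zero_le_one) (right_mem_Icc.2 zero_le_one)
  have hzv : z + v = z' := add_sub_cancel _ _
  simp only [one_smul, zero_smul, add_zero, hzv, zero_mul, norm_le_zero_iff, sub_eq_zero] at hb
  exact hb.symm

theorem canonicalH_eq (hred : IsPrimaryReduction U L W h f)
    (hγ : EnoughGenerators γ par) (hU : IsOpen U) (hL : IsSuperfunction 0 U L)
    {w : HatPt 𝕜 γ par P R} (hw : w ∈ W) :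
    canonicalH U L (hatToRed w) = energy L h f w := by
  have hr : ∃ x, x ∈ U ∧ LiesOver L x (hatToRed w) := ⟨_, hred.velOfHat_mem hw⟩
  rw [canonicalH, dif_pos hr]
  obtain ⟨w', hw', e, hx⟩ := hred.exists_velOfHat_eq hr.choose_spec.1 hr.choose_spec.2
  rw [hred.energy_eq hγ hU hL hw hw' e.symm, energy, hx, e]
  simp only [hred.surfaceMomentum_eq hr.choose_spec.1 hr.choose_spec.2]

end IsPrimaryReduction

end Reduction

/-! ### The primary constraints, the Hamiltonian and the velocities on phase space -/

section PhaseSpace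

variable {𝕜 γ ι : Type*} [RCLike 𝕜] [LinearOrder γ] [Fintype ι] [DecidableEq ι] {par : ι → ZMod 2}
  {P R : Finset ι} {U : Set (VelPt 𝕜 γ par)} {L : VelPt 𝕜 γ par → Grassmann 𝕜 γ}
  {W : Set (HatPt 𝕜 γ par P R)} {h : {A // A ∉ R} → HatPt 𝕜 γ par P R → Grassmann 𝕜 γ}
  {f : {A // A ∈ P} → RedPt 𝕜 γ par P → Grassmann 𝕜 γ}

theorem sdiffAt_toRed (y : PhasePt 𝕜 γ par)
    (M : ι ⊕ {A // A ∉ P}) : SDiffAt (fun z => ((toRed P z).2 M : Grassmann 𝕜 γ)) y := by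
  rcases M with A | a
  · exact sdiffAt_coord (.inl A) y
  · exact sdiffAt_coord (.inr a.1) y

theorem sdiffAt_liftHat_toRed (w : HatPt 𝕜 γ par P R) (y : PhasePt 𝕜 γ par)
    (M : ι ⊕ ({A // A ∉ P} ⊕ {A // A ∈ R})) :
    SDiffAt (fun z => ((liftHat w (toRed P z)).2 M : Grassmann 𝕜 γ)) y := by
  rcases M with A | a | m
  · exact sdiffAt_coord (.inl A) y
  · exact sdiffAt_coord (.inr a.1) y
  · exact sdiffAt_const (w.2 (.inr (.inr m)) : Grassmann 𝕜 γ) y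

theorem toRed_dirInr_of_mem {A : ι} (hA : A ∈ P) (k : part 𝕜 γ (par A)) :
    toRed P (dirInr par A k : PhasePt 𝕜 γ par) = 0 := by
  refine Prod.ext rfl (funext ?_)
  rintro (B | b)
  · rfl
  · exact Pi.single_eq_of_ne (M := fun A => part 𝕜 γ (par A)) (i := A) (i' := b.1)
      (fun e => b.2 (e.symm ▸ hA)) k

theorem toRed_dirInr_of_notMem {A : ι} (hA : A ∉ P) (k : part 𝕜 γ (par A)) :
    toRed P (dirInr par A k : PhasePt 𝕜 γ par)
      = dirInr (q := fun a : {A // A ∉ P} => par a) par ⟨A, hA⟩ k := by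
  refine Prod.ext rfl (funext ?_)
  rintro (B | ⟨B, hB⟩)
  · rfl
  · by_cases e : B = A
    · subst e
      exact (Pi.single_eq_same (M := fun A => part 𝕜 γ (par A)) B k).trans
        (Pi.single_eq_same (M := fun a : {A // A ∉ P} => part 𝕜 γ (par a)) ⟨B, hB⟩ k).symm
    · exact (Pi.single_eq_of_ne (M := fun A => part 𝕜 γ (par A)) e k).trans
        (Pi.single_eq_of_ne (M := fun a : {A // A ∉ P} => part 𝕜 γ (par a))
          (i := ⟨A, hA⟩) (i' := ⟨B, hB⟩) (fun e' => e (congrArg Subtype.val e')) k).symm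

theorem sum_dite_mem {M : Type*} [AddCommMonoid M] (F : {A // A ∈ P} → M) :
    ∑ A, (if hA : A ∈ P then F ⟨A, hA⟩ else 0) = ∑ m, F m := by
  rw [← Fintype.sum_subtype_add_sum_subtype (· ∈ P)]
  have h1 (i : {A // A ∈ P}) : (if hA : i.1 ∈ P then F ⟨i.1, hA⟩ else 0) = F i := dif_pos i.2
  have h2 (i : {A // A ∉ P}) : (if hA : i.1 ∈ P then F ⟨i.1, hA⟩ else 0) = 0 := dif_neg i.2
  simp only [h1, h2, Finset.sum_const_zero, add_zero]
  exact Finset.sum_congr (by ext; simp) fun _ _ => rfl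

namespace IsPrimaryReduction

variable {y : PhasePt 𝕜 γ par}

theorem enoughGenerators_red (hγ : EnoughGenerators γ par) :
    EnoughGenerators γ (Sum.elim par fun a : {A // A ∉ P} => par a) :=
  hγ.sumElim (hγ.comp _)

theorem eventually_toRed_mem (hred : IsPrimaryReduction U L W h f)
    (hy : toRed P y ∈ hatToRed '' W) : ∀ᶠ z in 𝓝 y, toRed P z ∈ hatToRed '' W :=
  continuous_toRed.continuousAt.eventually
    ((isOpen_hatToRed_image hred.isOpen).eventually_mem hy)

theorem sdiffAt_constraintFn (hred : IsPrimaryReduction U L W h f) (hγ : EnoughGenerators γ par)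
    (hy : toRed P y ∈ hatToRed '' W) (m : {A // A ∈ P}) : SDiffAt (constraintFn f m) y := by
  change SDiffAt (fun z : PhasePt 𝕜 γ par => (z.2 (.inr m.1) : Grassmann 𝕜 γ) - f m (toRed P z)) y
  exact (sdiffAt_coord (.inr m.1) y).sub
    (((hred.superfunction_f m).c1At (enoughGenerators_red hγ)
      (isOpen_hatToRed_image hred.isOpen) hy).comp (fun _ => rfl) (sdiffAt_toRed y))

theorem constraintFn_mem_part (hred : IsPrimaryReduction U L W h f)
    (hy : toRed P y ∈ hatToRed '' W) (m : {A // A ∈ P}) :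
    constraintFn f m y ∈ part 𝕜 γ (par m) :=
  Submodule.sub_mem _ (y.2 (.inr m.1)).2 ((hred.superfunction_f m).parity _ hy)

theorem leftDifferential_constraintFn_mem_part (hred : IsPrimaryReduction U L W h f)
    (hγ : EnoughGenerators γ par) (hy : toRed P y ∈ hatToRed '' W) (m : {A // A ∈ P})
    (v : PhasePt 𝕜 γ par) : leftDifferential (grad (constraintFn f m) y) v ∈ part 𝕜 γ (par m) :=
  leftDifferential_mem_part (hred.sdiffAt_constraintFn hγ hy m)
    ((hred.eventually_toRed_mem hy).mono fun _ hz => hred.constraintFn_mem_part hz m) v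

theorem leftDeriv_constraintFn (hred : IsPrimaryReduction U L W h f) (hγ : EnoughGenerators γ par)
    (hy : toRed P y ∈ hatToRed '' W) (m : {A // A ∈ P}) (A : ι) :
    leftDeriv (constraintFn f m) (.inr A) y = (if A = m then 1 else 0)
      - if hA : A ∈ P then 0 else leftDeriv (f m) (.inr ⟨A, hA⟩) (toRed P y) := by
  refine eq_of_part_mul_eq (hγ.apply A) fun k => ?_
  have h1 := (hred.sdiffAt_constraintFn hγ hy m).curveDeriv_line (dirInr par A k)
  rw [leftDifferential_dirInr] at h1
  refine h1.unique ?_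
  rw [mul_sub]
  refine CurveDeriv.sub ?_ ?_
  · have e : (k : Grassmann 𝕜 γ) * (if A = m then 1 else 0)
        = ((dirInr par A k : PhasePt 𝕜 γ par).2 (.inr m.1) : Grassmann 𝕜 γ) := by
      change _ = ((Pi.single A k : Vars 𝕜 γ par) m.1 : Grassmann 𝕜 γ)
      split_ifs with e
      · subst e
        simp
      · simp [Pi.single_eq_of_ne (Ne.symm e)]
    rw [e]
    exact (ptCurveDeriv_line y _).var (.inr m.1)
  · have h2 := ((hred.superfunction_f m).sdiffAt hy).curveDeriv_line
      (toRed P (dirInr par A k : PhasePt 𝕜 γ par))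
    simp only [toRed_line]
    split_ifs with hA
    · simp only [toRed_dirInr_of_mem hA, mul_zero, smul_zero, add_zero]
      exact CurveDeriv.const _
    · rw [toRed_dirInr_of_notMem hA, leftDifferential_dirInr] at h2
      simp only [toRed_dirInr_of_notMem hA]
      exact h2

theorem sdiffAt_leftDeriv_constraintFn (hred : IsPrimaryReduction U L W h f)
    (hγ : EnoughGenerators γ par) (hy : toRed P y ∈ hatToRed '' W) (m : {A // A ∈ P}) (A : ι) :
    SDiffAt (leftDeriv (constraintFn f m) (.inr A)) y := by
  have h1 : SDiffAt (fun z => (if A = m then 1 else 0 : Grassmann 𝕜 γ)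
      - if hA : A ∈ P then 0 else leftDeriv (f m) (.inr ⟨A, hA⟩) (toRed P z)) y := by
    refine (sdiffAt_const _ y).sub ?_
    split_ifs with hA
    · exact sdiffAt_const 0 y
    · exact (((hred.superfunction_f m).leftDeriv (enoughGenerators_red hγ)
        (isOpen_hatToRed_image hred.isOpen) (.inr ⟨A, hA⟩)).c1At (enoughGenerators_red hγ)
        (isOpen_hatToRed_image hred.isOpen) hy).comp (fun _ => rfl) (sdiffAt_toRed y)
  exact h1.congr ((hred.eventually_toRed_mem hy).mono fun z hz =>
    hred.leftDeriv_constraintFn hγ hz m A)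

variable {w : HatPt 𝕜 γ par P R}

theorem eventually_liftHat_mem (hred : IsPrimaryReduction U L W h f) (hw : w ∈ W)
    (hwy : hatToRed w = toRed P y) : ∀ᶠ z in 𝓝 y, liftHat w (toRed P z) ∈ W :=
  ((continuous_liftHat w).comp continuous_toRed).continuousAt.eventually
    (by
      rw [Function.comp_apply, ← hwy, liftHat_hatToRed]
      exact hred.isOpen.eventually_mem hw)

/-- The velocities over phase space, at fixed values of the free velocities. -/
theorem sdiffAt_velOfHat_liftHat (hred : IsPrimaryReduction U L W h f)
    (hγ : EnoughGenerators γ par) (hw : w ∈ W) (hwy : hatToRed w = toRed P y) (M : ι ⊕ ι) :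
    SDiffAt (fun z => ((velOfHat h (liftHat w (toRed P z))).2 M : Grassmann 𝕜 γ)) y :=
  hred.sdiffAt_velOfHat hγ (g := fun z => liftHat w (toRed P z))
    ((continuous_liftHat w).comp continuous_toRed).continuousAt (fun _ => rfl)
    (sdiffAt_liftHat_toRed w y)
    (by rwa [← hwy, liftHat_hatToRed]) M

theorem canonicalH_eventuallyEq (hred : IsPrimaryReduction U L W h f)
    (hγ : EnoughGenerators γ par) (hU : IsOpen U) (hL : IsSuperfunction 0 U L) (hw : w ∈ W)
    (hwy : hatToRed w = toRed P y) :
    (fun z : PhasePt 𝕜 γ par => canonicalH U L (toRed P z)) =ᶠ[𝓝 y]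
      fun z => energy L h f (liftHat w (toRed P z)) :=
  (hred.eventually_liftHat_mem hw hwy).mono fun z hz => by
    have := hred.canonicalH_eq hγ hU hL hz
    rwa [hatToRed_liftHat] at this

theorem sdiffAt_surfaceMomentum (hred : IsPrimaryReduction U L W h f)
    (hγ : EnoughGenerators γ par) (hy : toRed P y ∈ hatToRed '' W) (A : ι) :
    SDiffAt (fun z => surfaceMomentum f A (toRed P z)) y := by
  simp only [surfaceMomentum_toRed]
  refine (sdiffAt_coord (.inr A) y).sub ?_
  split_ifs with hA
  · exact hred.sdiffAt_constraintFn hγ hy ⟨A, hA⟩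
  · exact sdiffAt_const 0 y

theorem sdiffAt_canonicalH (hred : IsPrimaryReduction U L W h f)
    (hγ : EnoughGenerators γ par) (hU : IsOpen U) (hL : IsSuperfunction 0 U L) (hw : w ∈ W)
    (hwy : hatToRed w = toRed P y) :
    SDiffAt (fun z : PhasePt 𝕜 γ par => canonicalH U L (toRed P z)) y := by
  refine SDiffAt.congr ?_ (hred.canonicalH_eventuallyEq hγ hU hL hw hwy)
  have e : liftHat w (toRed P y) = w := by rw [← hwy, liftHat_hatToRed]
  have hs := hred.sdiffAt_velOfHat_liftHat hγ hw hwy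
  unfold energy
  simp only [hatToRed_liftHat]
  refine SDiffAt.sub (SDiffAt.sum fun A _ => (hs (.inr A)).mul
    ((velOfHat h (liftHat w (toRed P y))).2 (.inr A)).2
    (hred.sdiffAt_surfaceMomentum hγ ⟨w, hw, hwy⟩ A)) ?_
  exact C1At.comp (g := fun z => velOfHat h (liftHat w (toRed P z)))
    (hL.c1At (hγ.sumElim hγ) hU (e.symm ▸ (hred.velOfHat_mem hw).1)) (fun _ => rfl) hs

/-- The variation `δH = q̇^A δp_A - q̇^m δφ_m - δt ∂L/∂t - δq^A ∂L/∂q^A` of the canonical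
Hamiltonian, for any velocities compatible with the momenta. -/
theorem leftDifferential_canonicalH (hred : IsPrimaryReduction U L W h f)
    (hγ : EnoughGenerators γ par) (hU : IsOpen U) (hL : IsSuperfunction 0 U L) (hw : w ∈ W)
    (hwy : hatToRed w = toRed P y) (v : PhasePt 𝕜 γ par) :
    leftDifferential (grad (fun z : PhasePt 𝕜 γ par => canonicalH U L (toRed P z)) y) v
      = ∑ A, ((velOfHat h w).2 (.inr A) : Grassmann 𝕜 γ) * v.2 (.inr A)
        - ∑ m : {A // A ∈ P}, ((velOfHat h w).2 (.inr m.1) : Grassmann 𝕜 γ)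
            * leftDifferential (grad (constraintFn f m) y) v
        - v.1 • timeDeriv L (velOfHat h w)
        - ∑ A, (v.2 (.inl A) : Grassmann 𝕜 γ) * leftDeriv L (.inl A) (velOfHat h w) := by
  have e : liftHat w (toRed P y) = w := by rw [← hwy, liftHat_hatToRed]
  have hy : toRed P y ∈ hatToRed '' W := ⟨w, hw, hwy⟩
  have hc := ptCurveDeriv_comp (g := fun z => velOfHat h (liftHat w (toRed P z)))
    (fun z => rfl) (hred.sdiffAt_velOfHat_liftHat hγ hw hwy) v
  have hv (A : ι) : (fun z : PhasePt 𝕜 γ par =>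
      ((velOfHat h (liftHat w (toRed P z))).2 (.inl A) : Grassmann 𝕜 γ))
      = fun z : PhasePt 𝕜 γ par => (z.2 (.inl A) : Grassmann 𝕜 γ) := rfl
  have hq (A : ι) : leftDifferential (grad (fun z : PhasePt 𝕜 γ par =>
      ((velOfHat h (liftHat w (toRed P z))).2 (.inl A) : Grassmann 𝕜 γ)) y) v = v.2 (.inl A) := by
    rw [hv]
    exact leftDifferential_grad_coord (.inl A) y v
  have hp (A : ι) : CurveDeriv (fun s : ℝ => surfaceMomentum f A (toRed P (y + s • v)))
      (v.2 (.inr A) - if hA : A ∈ P then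
        leftDifferential (grad (constraintFn f ⟨A, hA⟩) y) v else 0) := by
    simp only [surfaceMomentum_toRed]
    refine ((ptCurveDeriv_line y v).var (.inr A)).sub ?_
    split_ifs with hA
    · exact (hred.sdiffAt_constraintFn hγ hy ⟨A, hA⟩).curveDeriv_line v
    · exact CurveDeriv.const 0
  have h1 := curveDeriv_energy hγ hU hL hc
    (by simpa only [line_zero, e] using (hred.velOfHat_mem hw).1) hp
    (fun A => by
      have := hred.surfaceMomentum_eq (hred.velOfHat_mem hw).1 (hred.velOfHat_mem hw).2 A
      rw [hwy] at this
      simpa only [line_zero, e] using this)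
  have h2 := ((hred.sdiffAt_canonicalH hγ hU hL hw hwy).curveDeriv_line v).unique
    (h1.congr ((tendsto_line y v).eventually (hred.canonicalH_eventuallyEq hγ hU hL hw hwy)
      |>.mono fun s hs => hs.trans (by simp only [energy, hatToRed_liftHat])))
  rw [h2]
  simp only [line_zero, e, hq, mul_sub, Finset.sum_sub_distrib]
  rw [← sum_dite_mem]
  congr 4
  refine funext fun A => ?_
  split_ifs
  · rfl
  · exact mul_zero _

/-- The velocities are recovered from the Hamiltonian, the constraints and the velocities
`q̇^m`. -/
theorem velocity_eq (hred : IsPrimaryReduction U L W h f)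
    (hγ : EnoughGenerators γ par) (hU : IsOpen U) (hL : IsSuperfunction 0 U L) (hw : w ∈ W)
    (hwy : hatToRed w = toRed P y) (A : ι) :
    velocity U L f (fun m => ((velOfHat h w).2 (.inr m.1) : Grassmann 𝕜 γ)) A y
      = (velOfHat h w).2 (.inr A) := by
  refine eq_of_part_mul_eq (hγ.apply A) fun k => ?_
  have h1 := hred.leftDifferential_canonicalH hγ hU hL hw hwy (dirInr par A k)
  have hp : ∑ B, ((velOfHat h w).2 (.inr B) : Grassmann 𝕜 γ)
      * (dirInr par A k : PhasePt 𝕜 γ par).2 (.inr B) = (velOfHat h w).2 (.inr A) * k := by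
    rw [Finset.sum_eq_single A]
    · simp [dirInr]
    · intro B _ hB
      simp [dirInr, Pi.single_eq_of_ne hB]
    · simp
  have hq : ∑ B, ((dirInr par A k : PhasePt 𝕜 γ par).2 (.inl B) : Grassmann 𝕜 γ)
      * leftDeriv L (.inl B) (velOfHat h w) = 0 :=
    Finset.sum_eq_zero fun B _ => zero_mul _
  have ht : (dirInr par A k : PhasePt 𝕜 γ par).1 • timeDeriv L (velOfHat h w) = 0 := zero_smul _ _
  rw [hp, hq, ht, sub_zero, sub_zero] at h1
  simp only [leftDifferential_dirInr, grad] at h1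
  have hm (m : {A // A ∈ P}) : (k : Grassmann 𝕜 γ) * (sgn (par A * (1 + par m)) •
      (((velOfHat h w).2 (.inr m.1) : Grassmann 𝕜 γ) * leftDeriv (constraintFn f m) (.inr A) y))
      = sgn (par A) • (((velOfHat h w).2 (.inr m.1) : Grassmann 𝕜 γ)
        * (k * leftDeriv (constraintFn f m) (.inr A) y)) := by
    rw [mul_smul_comm, ← mul_assoc, mul_comm_of_mem_part k.2 ((velOfHat h w).2 (.inr m.1)).2,
      smul_mul_assoc, smul_smul, mul_add, mul_one, sgn_add, mul_assoc]
    change (_ * (sgn (par A * par m) * sgn (par A * par m))) • _ = _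
    rw [sgn_mul_self_eq_one, mul_one, mul_assoc]
  rw [velocity, mul_add, mul_smul_comm, h1, Finset.mul_sum]
  simp only [hm]
  rw [← Finset.smul_sum, ← smul_add, sub_add_cancel,
    mul_comm_of_mem_part ((velOfHat h w).2 (.inr A)).2 k.2]
  change sgn (par A) • sgn (par A * par A) • _ = _
  rw [sgn_self_mul, sgn_smul_sgn_smul]

end IsPrimaryReduction

end PhaseSpace

/-! ### The total Noether charge and the total Hamiltonian -/

section Charge

variable {𝕜 γ ι : Type*} [RCLike 𝕜] [LinearOrder γ] [Fintype ι] [DecidableEq ι] {par : ι → ZMod 2}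
  {P R : Finset ι} {U : Set (VelPt 𝕜 γ par)} {L : VelPt 𝕜 γ par → Grassmann 𝕜 γ}
  {W : Set (HatPt 𝕜 γ par P R)} {h : {A // A ∉ R} → HatPt 𝕜 γ par P R → Grassmann 𝕜 γ}
  {f : {A // A ∈ P} → RedPt 𝕜 γ par P → Grassmann 𝕜 γ}
  {u : {A // A ∈ P} → PhasePt 𝕜 γ par → Grassmann 𝕜 γ} {Y : Set (PhasePt 𝕜 γ par)}
  {y : PhasePt 𝕜 γ par}

/-- At each point of `Y`, the multipliers `u` are, up to signs, the velocities `q̇^m` of a point of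
`U` with the same independent momenta. -/
def CompatibleMultipliers (U : Set (VelPt 𝕜 γ par)) (L : VelPt 𝕜 γ par → Grassmann 𝕜 γ)
    (u : {A // A ∈ P} → PhasePt 𝕜 γ par → Grassmann 𝕜 γ) (Y : Set (PhasePt 𝕜 γ par)) : Prop :=
  ∀ y ∈ Y, ∃ x ∈ U, LiesOver L x (toRed P y) ∧
    ∀ m : {A // A ∈ P}, (x.2 (.inr m.1) : Grassmann 𝕜 γ) = sgn (par m) • u m y

namespace IsPrimaryReduction

theorem velAt_eq (hred : IsPrimaryReduction U L W h f) (hγ : EnoughGenerators γ par)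
    (hU : IsOpen U) (hL : IsSuperfunction 0 U L) {w : HatPt 𝕜 γ par P R} (hw : w ∈ W)
    (hwy : hatToRed w = toRed P y)
    (hwu : ∀ m : {A // A ∈ P},
      ((velOfHat h w).2 (.inr m.1) : Grassmann 𝕜 γ) = sgn (par m) • u m y) :
    velAt U L f u y = velOfHat h w := by
  refine Prod.ext (congrArg Prod.fst hwy).symm (funext ?_)
  rintro (A | A)
  · exact (congrFun (congrArg Prod.snd hwy) (.inl A)).symm
  · -- the velocities are homogeneous, so that projecting them to their degree changes nothing
    refine Subtype.ext ?_
    have h1 := hred.velocity_eq hγ hU hL hw hwy A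
    simp only [hwu] at h1
    change (homog (par A) (velocity U L f (fun m => sgn (par m) • u m y) A y) : Grassmann 𝕜 γ) = _
    rw [h1]
    exact homog_coe ((velOfHat h w).2 (.inr A)).2

theorem exists_hat_of_mem (hred : IsPrimaryReduction U L W h f)
    (hYU : CompatibleMultipliers U L u Y) (hy : y ∈ Y) :
    ∃ w ∈ W, hatToRed w = toRed P y ∧ ∀ m : {A // A ∈ P},
      ((velOfHat h w).2 (.inr m.1) : Grassmann 𝕜 γ) = sgn (par m) • u m y := by
  obtain ⟨x, hx, hxy, hxu⟩ := hYU y hy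
  obtain ⟨w, hw, hwy, rfl⟩ := hred.exists_velOfHat_eq hx hxy
  exact ⟨w, hw, hwy, hxu⟩

theorem velAt_mem (hred : IsPrimaryReduction U L W h f) (hγ : EnoughGenerators γ par)
    (hU : IsOpen U) (hL : IsSuperfunction 0 U L)
    (hYU : CompatibleMultipliers U L u Y) (hy : y ∈ Y) :
    velAt U L f u y ∈ U ∧ LiesOver L (velAt U L f u y) (toRed P y) := by
  obtain ⟨w, hw, hwy, hwu⟩ := hred.exists_hat_of_mem hYU hy
  rw [hred.velAt_eq hγ hU hL hw hwy hwu, ← hwy]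
  exact hred.velOfHat_mem hw

theorem velocity_eq_add (v v' : {A // A ∈ P} → Grassmann 𝕜 γ) (A : ι) :
    velocity U L f v A y = velocity U L f v' A y + ∑ m : {A // A ∈ P},
      sgn (par A * (1 + par m)) • ((v m - v' m) * leftDeriv (constraintFn f m) (.inr A) y) := by
  simp only [velocity, sub_mul, smul_sub, Finset.sum_sub_distrib]
  abel

/-- Near a given point, the velocities are compared with those at fixed values of the free
velocities `q̇^m̂`, which are superdifferentiable. -/
theorem sdiffAt_velAt (hred : IsPrimaryReduction U L W h f) (hγ : EnoughGenerators γ par)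
    (hU : IsOpen U) (hL : IsSuperfunction 0 U L) (hY : IsOpen Y)
    (hu : ∀ m : {A // A ∈ P}, IsSuperfunction (par m) Y (u m))
    (hYU : CompatibleMultipliers U L u Y) (hy : y ∈ Y)
    (M : ι ⊕ ι) : SDiffAt (fun z => ((velAt U L f u z).2 M : Grassmann 𝕜 γ)) y := by
  rcases M with A | A
  · exact sdiffAt_coord (.inl A) y
  obtain ⟨w, hw, hwy, -⟩ := hred.exists_hat_of_mem hYU hy
  have hs := hred.sdiffAt_velOfHat_liftHat hγ hw hwy
  have h1 : SDiffAt (fun z => ((velOfHat h (liftHat w (toRed P z))).2 (.inr A) : Grassmann 𝕜 γ)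
      + ∑ m : {A // A ∈ P}, sgn (par A * (1 + par m)) • ((sgn (par m) • u m z
        - (velOfHat h (liftHat w (toRed P z))).2 (.inr m.1))
          * leftDeriv (constraintFn f m) (.inr A) z)) y := by
    refine (hs (.inr A)).add (SDiffAt.sum fun m _ => SDiffAt.zsmul _ (SDiffAt.mul (a := par m)
      (SDiffAt.sub (((hu m).sdiffAt hy).zsmul _) (hs (.inr m.1))) ?_
      (hred.sdiffAt_leftDeriv_constraintFn hγ ⟨w, hw, hwy⟩ m A)))
    exact Submodule.sub_mem _ (zsmul_mem_part _ ((hu m).parity y hy)) (Subtype.coe_prop _)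
  refine h1.congr ?_
  filter_upwards [hY.mem_nhds hy, hred.eventually_liftHat_mem hw hwy] with z hz hzW
  obtain ⟨w', hw', hwz, hwu⟩ := hred.exists_hat_of_mem hYU hz
  have h2 := hred.velocity_eq hγ hU hL hw' hwz A
  simp only [hwu] at h2
  rw [hred.velAt_eq hγ hU hL hw' hwz hwu, ← h2,
    ← hred.velocity_eq hγ hU hL hzW (hatToRed_liftHat w (toRed P z)) A]
  exact velocity_eq_add _ _ A

theorem sdiffAt_totalH (hred : IsPrimaryReduction U L W h f) (hγ : EnoughGenerators γ par)
    (hU : IsOpen U) (hL : IsSuperfunction 0 U L)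
    (hu : ∀ m : {A // A ∈ P}, IsSuperfunction (par m) Y (u m))
    (hYU : CompatibleMultipliers U L u Y) (hy : y ∈ Y) :
    SDiffAt (totalH U L f u) y := by
  obtain ⟨w, hw, hwy, -⟩ := hred.exists_hat_of_mem hYU hy
  exact (hred.sdiffAt_canonicalH hγ hU hL hw hwy).add (SDiffAt.sum fun m _ =>
    (hred.sdiffAt_constraintFn hγ ⟨w, hw, hwy⟩ m).mul
      (hred.constraintFn_mem_part ⟨w, hw, hwy⟩ m) ((hu m).sdiffAt hy))

/-- The variation of the total Hamiltonian at a point of the constraint surface: the terms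
`δφ_m u^m` compensate the terms `q̇^m δφ_m` in the variation of the canonical Hamiltonian. -/
theorem leftDifferential_totalH (hred : IsPrimaryReduction U L W h f)
    (hγ : EnoughGenerators γ par) (hU : IsOpen U) (hL : IsSuperfunction 0 U L)
    (hu : ∀ m : {A // A ∈ P}, IsSuperfunction (par m) Y (u m))
    (hYU : CompatibleMultipliers U L u Y) (hy : y ∈ Y)
    (hyV : ∀ m : {A // A ∈ P}, constraintFn f m y = 0) (v : PhasePt 𝕜 γ par) :
    leftDifferential (grad (totalH U L f u) y) v
      = ∑ A, ((velAt U L f u y).2 (.inr A) : Grassmann 𝕜 γ) * v.2 (.inr A)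
        - v.1 • timeDeriv L (velAt U L f u y)
        - ∑ A, (v.2 (.inl A) : Grassmann 𝕜 γ) * leftDeriv L (.inl A) (velAt U L f u y) := by
  obtain ⟨w, hw, hwy, hwu⟩ := hred.exists_hat_of_mem hYU hy
  have h1 := (hred.sdiffAt_canonicalH hγ hU hL hw hwy).curveDeriv_line v
  rw [hred.leftDifferential_canonicalH hγ hU hL hw hwy] at h1
  have h2 := CurveDeriv.sum (S := Finset.univ) fun m _ =>
    ((hred.sdiffAt_constraintFn hγ ⟨w, hw, hwy⟩ m).curveDeriv_line v).mul
      (((hu m).sdiffAt hy).curveDeriv_line v)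
  simp only [line_zero, hyV, zero_mul, add_zero] at h2
  rw [((hred.sdiffAt_totalH hγ hU hL hu hYU hy).curveDeriv_line v).unique (h1.add h2),
    hred.velAt_eq hγ hU hL hw hwy hwu]
  have h3 (m : {A // A ∈ P}) : leftDifferential (grad (constraintFn f m) y) v * u m y
      = ((velOfHat h w).2 (.inr m.1) : Grassmann 𝕜 γ)
        * leftDifferential (grad (constraintFn f m) y) v := by
    rw [hwu, mul_comm_of_mem_part
      (hred.leftDifferential_constraintFn_mem_part hγ ⟨w, hw, hwy⟩ m v) ((hu m).parity y hy),
      sgn_self_mul, smul_mul_assoc]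
  simp only [h3]
  abel

theorem leftDeriv_totalH_inl (hred : IsPrimaryReduction U L W h f)
    (hγ : EnoughGenerators γ par) (hU : IsOpen U) (hL : IsSuperfunction 0 U L)
    (hu : ∀ m : {A // A ∈ P}, IsSuperfunction (par m) Y (u m))
    (hYU : CompatibleMultipliers U L u Y) (hy : y ∈ Y)
    (hyV : ∀ m : {A // A ∈ P}, constraintFn f m y = 0) (A : ι) :
    leftDeriv (totalH U L f u) (.inl A) y = -leftDeriv L (.inl A) (velAt U L f u y) := by
  refine eq_of_part_mul_eq (hγ.apply A) fun k => ?_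
  have h1 := hred.leftDifferential_totalH hγ hU hL hu hYU hy hyV (dirInl par A k)
  rw [leftDifferential_dirInl] at h1
  refine h1.trans ?_
  simp [dirInl, sum_single_mul]

theorem leftDeriv_totalH_inr (hred : IsPrimaryReduction U L W h f)
    (hγ : EnoughGenerators γ par) (hU : IsOpen U) (hL : IsSuperfunction 0 U L)
    (hu : ∀ m : {A // A ∈ P}, IsSuperfunction (par m) Y (u m))
    (hYU : CompatibleMultipliers U L u Y) (hy : y ∈ Y)
    (hyV : ∀ m : {A // A ∈ P}, constraintFn f m y = 0) (A : ι) :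
    leftDeriv (totalH U L f u) (.inr A) y
      = sgn (par A) • ((velAt U L f u y).2 (.inr A) : Grassmann 𝕜 γ) := by
  refine eq_of_part_mul_eq (hγ.apply A) fun k => ?_
  have h1 := hred.leftDifferential_totalH hγ hU hL hu hYU hy hyV (dirInr par A k)
  rw [leftDifferential_dirInr] at h1
  refine h1.trans ?_
  have h2 (B : ι) : ((velAt U L f u y).2 (.inr B) : Grassmann 𝕜 γ)
      * ((Pi.single A k : Vars 𝕜 γ par) B) = sgn (par B * par B) •
        (((Pi.single A k : Vars 𝕜 γ par) B : Grassmann 𝕜 γ) * (velAt U L f u y).2 (.inr B)) :=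
    mul_comm_of_mem_part ((velAt U L f u y).2 (.inr B)).2 (Subtype.coe_prop _)
  simp only [dirInr, h2, sgn_self_mul, ← mul_smul_comm, sum_single_mul]
  simp

variable {δq : ι → VelPt 𝕜 γ par → Grassmann 𝕜 γ} {δK : VelPt 𝕜 γ par → Grassmann 𝕜 γ}

theorem sdiffAt_totalNoether (hred : IsPrimaryReduction U L W h f) (hγ : EnoughGenerators γ par)
    (hU : IsOpen U) (hL : IsSuperfunction 0 U L) (hsym : IsLagrangianSymmetry U L δq δK)
    (hY : IsOpen Y) (hu : ∀ m : {A // A ∈ P}, IsSuperfunction (par m) Y (u m))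
    (hYU : CompatibleMultipliers U L u Y) (hy : y ∈ Y) :
    SDiffAt (totalNoether U L f u δq δK) y := by
  have hx := (hred.velAt_mem hγ hU hL hYU hy).1
  have hs := hred.sdiffAt_velAt hγ hU hL hY hu hYU hy
  exact (SDiffAt.sum fun A _ => SDiffAt.mul
    (((hsym.superfunction_q A).c1At (hγ.sumElim hγ) hU hx).comp (fun _ => rfl) hs)
    ((hsym.superfunction_q A).parity _ hx) (sdiffAt_coord (.inr A) y)).sub
    ((hsym.superfunction_K.c1At (hγ.sumElim hγ) hU hx).comp (fun _ => rfl) hs)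

/-- The variation of the total Noether charge at a point of the constraint surface.  There the
momenta are `∂L/∂q̇^A`, so that the variations of the velocities cancel by the part of the Noether
identity linear in the accelerations. -/
theorem leftDifferential_totalNoether (hred : IsPrimaryReduction U L W h f)
    (hγ : EnoughGenerators γ par) (hU : IsOpen U) (hL : IsSuperfunction 0 U L)
    (hsym : IsLagrangianSymmetry U L δq δK) (hY : IsOpen Y)
    (hu : ∀ m : {A // A ∈ P}, IsSuperfunction (par m) Y (u m))
    (hYU : CompatibleMultipliers U L u Y) (hy : y ∈ Y)
    (hyV : ∀ m : {A // A ∈ P}, constraintFn f m y = 0) (v : PhasePt 𝕜 γ par) :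
    leftDifferential (grad (totalNoether U L f u δq δK) y) v
      = ∑ A, δq A (velAt U L f u y) * v.2 (.inr A)
        - ∑ A, (v.2 (.inl A) : Grassmann 𝕜 γ) * deltaP L δq δK A (velAt U L f u y)
        + v.1 • (∑ A, timeDeriv (δq A) (velAt U L f u y) * momentum L A (velAt U L f u y)
          - timeDeriv δK (velAt U L f u y)) := by
  obtain ⟨hx, hxy⟩ := hred.velAt_mem hγ hU hL hYU hy
  have hs := hγ.sumElim hγ
  obtain ⟨v', hc, ht, hq⟩ : ∃ v', PtCurveDeriv (fun s : ℝ => velAt U L f u (y + s • v)) v' ∧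
      v'.1 = v.1 ∧ ∀ A, (v'.2 (.inl A) : Grassmann 𝕜 γ) = v.2 (.inl A) := by
    refine ⟨_, ptCurveDeriv_comp (g := velAt U L f u) (fun _ => rfl)
      (hred.sdiffAt_velAt hγ hU hL hY hu hYU hy) v, rfl, fun A => ?_⟩
    have hv : (fun z : PhasePt 𝕜 γ par => ((velAt U L f u z).2 (.inl A) : Grassmann 𝕜 γ))
        = fun z : PhasePt 𝕜 γ par => (z.2 (.inl A) : Grassmann 𝕜 γ) := rfl
    change leftDifferential (grad (fun z : PhasePt 𝕜 γ par =>
      ((velAt U L f u z).2 (.inl A) : Grassmann 𝕜 γ)) y) v = _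
    rw [hv]
    exact leftDifferential_grad_coord (.inl A) y v
  have hp (A : ι) : (y.2 (.inr A) : Grassmann 𝕜 γ) = momentum L A (velAt U L f u y) := by
    rw [← hred.surfaceMomentum_eq hx hxy, surfaceMomentum_toRed]
    split_ifs with hA
    · rw [hyV, sub_zero]
    · rw [sub_zero]
  have h0 : velAt U L f u (y + (0 : ℝ) • v) ∈ U := by rwa [line_zero]
  have h1 := (CurveDeriv.sum (S := Finset.univ) fun A _ =>
    (((hsym.superfunction_q A).c1At hs hU h0).curveDeriv hc).mul
      ((ptCurveDeriv_line y v).var (.inr A))).sub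
    ((hsym.superfunction_K.c1At hs hU h0).curveDeriv hc)
  rw [((hred.sdiffAt_totalNoether hγ hU hL hsym hY hu hYU hy).curveDeriv_line v).unique h1]
  simp only [line_zero, leftDifferential, Fintype.sum_sum_type, grad, ht, hq, hp, deltaP,
    ← hsym.sum_leftDeriv_mul_momentum hγ hx, mul_sub, add_mul, Finset.sum_add_distrib,
    Finset.sum_sub_distrib, Finset.sum_mul, Finset.mul_sum, smul_sub, Finset.smul_sum,
    real_smul_mul, mul_assoc]
  rw [Finset.sum_comm (f := fun A B => (v.2 (.inl B) : Grassmann 𝕜 γ)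
      * (leftDeriv (δq A) (.inl B) (velAt U L f u y) * momentum L A (velAt U L f u y))),
    Finset.sum_comm (f := fun A B => (v'.2 (.inr B) : Grassmann 𝕜 γ)
      * (leftDeriv (δq A) (.inr B) (velAt U L f u y) * momentum L A (velAt U L f u y)))]
  abel

theorem leftDeriv_totalNoether_inl (hred : IsPrimaryReduction U L W h f)
    (hγ : EnoughGenerators γ par) (hU : IsOpen U) (hL : IsSuperfunction 0 U L)
    (hsym : IsLagrangianSymmetry U L δq δK) (hY : IsOpen Y)
    (hu : ∀ m : {A // A ∈ P}, IsSuperfunction (par m) Y (u m))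
    (hYU : CompatibleMultipliers U L u Y) (hy : y ∈ Y)
    (hyV : ∀ m : {A // A ∈ P}, constraintFn f m y = 0) (A : ι) :
    leftDeriv (totalNoether U L f u δq δK) (.inl A) y
      = -deltaP L δq δK A (velAt U L f u y) := by
  refine eq_of_part_mul_eq (hγ.apply A) fun k => ?_
  have h1 := hred.leftDifferential_totalNoether hγ hU hL hsym hY hu hYU hy hyV (dirInl par A k)
  rw [leftDifferential_dirInl] at h1
  refine h1.trans ?_
  simp [dirInl, sum_single_mul]

theorem leftDeriv_totalNoether_inr (hred : IsPrimaryReduction U L W h f)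
    (hγ : EnoughGenerators γ par) (hU : IsOpen U) (hL : IsSuperfunction 0 U L)
    (hsym : IsLagrangianSymmetry U L δq δK) (hY : IsOpen Y)
    (hu : ∀ m : {A // A ∈ P}, IsSuperfunction (par m) Y (u m))
    (hYU : CompatibleMultipliers U L u Y) (hy : y ∈ Y)
    (hyV : ∀ m : {A // A ∈ P}, constraintFn f m y = 0) (A : ι) :
    leftDeriv (totalNoether U L f u δq δK) (.inr A) y
      = sgn (par A) • δq A (velAt U L f u y) := by
  refine eq_of_part_mul_eq (hγ.apply A) fun k => ?_
  have h1 := hred.leftDifferential_totalNoether hγ hU hL hsym hY hu hYU hy hyV (dirInr par A k)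
  rw [leftDifferential_dirInr] at h1
  refine h1.trans ?_
  have hx := (hred.velAt_mem hγ hU hL hYU hy).1
  have h2 (B : ι) : δq B (velAt U L f u y) * ((Pi.single A k : Vars 𝕜 γ par) B)
      = sgn (par B * par B) •
        (((Pi.single A k : Vars 𝕜 γ par) B : Grassmann 𝕜 γ) * δq B (velAt U L f u y)) :=
    mul_comm_of_mem_part ((hsym.superfunction_q B).parity _ hx) (Subtype.coe_prop _)
  simp only [dirInr, h2, sgn_self_mul, ← mul_smul_comm, sum_single_mul]
  simp

theorem timeDeriv_totalNoether (hred : IsPrimaryReduction U L W h f)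
    (hγ : EnoughGenerators γ par) (hU : IsOpen U) (hL : IsSuperfunction 0 U L)
    (hsym : IsLagrangianSymmetry U L δq δK) (hY : IsOpen Y)
    (hu : ∀ m : {A // A ∈ P}, IsSuperfunction (par m) Y (u m))
    (hYU : CompatibleMultipliers U L u Y) (hy : y ∈ Y)
    (hyV : ∀ m : {A // A ∈ P}, constraintFn f m y = 0) :
    timeDeriv (totalNoether U L f u δq δK) y
      = ∑ A, timeDeriv (δq A) (velAt U L f u y) * momentum L A (velAt U L f u y)
        - timeDeriv δK (velAt U L f u y) := by
  have h1 := hred.leftDifferential_totalNoether hγ hU hL hsym hY hu hYU hy hyV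
    (timeDirection 𝕜 γ (Sum.elim par par))
  rw [leftDifferential_timeDirection] at h1
  refine h1.trans ?_
  simp [timeDirection]

end IsPrimaryReduction

/-! ### Poisson brackets -/

theorem poisson_coord_inl (hγ : EnoughGenerators γ par) (F : PhasePt 𝕜 γ par → Grassmann 𝕜 γ)
    (A : ι) (y : PhasePt 𝕜 γ par) :
    poisson 0 F (fun z => (z.2 (.inl A) : Grassmann 𝕜 γ)) y
      = -(sgn (par A) • leftDeriv F (.inr A) y) := by
  have h1 (M : ι ⊕ ι) : leftDeriv (fun z : PhasePt 𝕜 γ par => (z.2 (.inl A) : Grassmann 𝕜 γ)) M y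
      = (Pi.single (.inl A) 1 : ι ⊕ ι → Grassmann 𝕜 γ) M :=
    congrFun (congrArg Prod.snd
      ((isLeftDiffAt_coord (par := Sum.elim par par) (Sum.inl A) y).grad_eq (hγ.sumElim hγ))) M
  simp only [poisson, h1]
  rw [Finset.sum_eq_single A]
  · simp
  · intro B _ hB
    simp [hB]
  · simp

theorem poisson_coord_inr (hγ : EnoughGenerators γ par) (F : PhasePt 𝕜 γ par → Grassmann 𝕜 γ)
    (A : ι) (y : PhasePt 𝕜 γ par) :
    poisson 0 F (fun z => (z.2 (.inr A) : Grassmann 𝕜 γ)) y = leftDeriv F (.inl A) y := by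
  have h1 (M : ι ⊕ ι) : leftDeriv (fun z : PhasePt 𝕜 γ par => (z.2 (.inr A) : Grassmann 𝕜 γ)) M y
      = (Pi.single (.inr A) 1 : ι ⊕ ι → Grassmann 𝕜 γ) M :=
    congrFun (congrArg Prod.snd
      ((isLeftDiffAt_coord (par := Sum.elim par par) (Sum.inr A) y).grad_eq (hγ.sumElim hγ))) M
  simp only [poisson, h1]
  rw [Finset.sum_eq_single A]
  · simp [sgn]
  · intro B _ hB
    simp [hB]
  · simp

theorem IsLagrangianSymmetry.deltaP_mem_part (hsym : IsLagrangianSymmetry U L δq δK)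
    (hγ : EnoughGenerators γ par) (hU : IsOpen U) (hL : IsSuperfunction 0 U L)
    {x : VelPt 𝕜 γ par} (hx : x ∈ U) (A : ι) : deltaP L δq δK A x ∈ part 𝕜 γ (par A) := by
  have hs := hγ.sumElim hγ
  have h1 := (hsym.superfunction_K.leftDeriv hs hU (.inl A)).parity x hx
  refine Submodule.sub_mem _ (by simpa using h1) (Submodule.sum_mem _ fun B _ => ?_)
  have h2 := mul_mem_part (((hsym.superfunction_q B).leftDeriv hs hU (.inl A)).parity x hx)
    ((hL.leftDeriv hs hU (.inr B)).parity x hx)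
  simp only [Sum.elim_inl, Sum.elim_inr] at h2
  rwa [(by decide : ∀ a b : ZMod 2, b + a + (0 + b) = a) (par A) (par B)] at h2

/-- The part of the Noether identity independent of the accelerations, with the terms collected
into the variations `δp_A` of the momenta. -/
theorem IsLagrangianSymmetry.noether_identity (hsym : IsLagrangianSymmetry U L δq δK)
    {x : VelPt 𝕜 γ par} (hx : x ∈ U) :
    ∑ A, (δq A x * leftDeriv L (.inl A) x
        - (x.2 (.inr A) : Grassmann 𝕜 γ) * deltaP L δq δK A x)
      + (∑ A, timeDeriv (δq A) x * momentum L A x - timeDeriv δK x) = 0 := by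
  have h1 := hsym.variation_eq x hx 0
  simp only [variation, totalDeriv, Pi.zero_apply, ZeroMemClass.coe_zero, zero_mul,
    Finset.sum_const_zero, add_zero] at h1
  simp only [deltaP, mul_sub, Finset.mul_sum, Finset.sum_sub_distrib, add_mul,
    Finset.sum_add_distrib, Finset.sum_mul, mul_assoc] at h1 ⊢
  rw [Finset.sum_comm (f := fun A B => (x.2 (.inr B) : Grassmann 𝕜 γ) * _)] at h1
  rw [← sub_eq_zero] at h1
  rw [← h1]
  simp only [momentum]
  abel

namespace IsPrimaryReduction

theorem poisson_totalNoether_totalH_add_timeDeriv (hred : IsPrimaryReduction U L W h f)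
    (hγ : EnoughGenerators γ par) (hU : IsOpen U) (hL : IsSuperfunction 0 U L)
    (hsym : IsLagrangianSymmetry U L δq δK) (hY : IsOpen Y)
    (hu : ∀ m : {A // A ∈ P}, IsSuperfunction (par m) Y (u m))
    (hYU : CompatibleMultipliers U L u Y) (hy : y ∈ Y)
    (hyV : ∀ m : {A // A ∈ P}, constraintFn f m y = 0) :
    poisson 0 (totalNoether U L f u δq δK) (totalH U L f u) y
      + timeDeriv (totalNoether U L f u δq δK) y = 0 := by
  have hx := (hred.velAt_mem hγ hU hL hYU hy).1
  rw [hred.timeDeriv_totalNoether hγ hU hL hsym hY hu hYU hy hyV, ← hsym.noether_identity hx]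
  unfold poisson
  congr 1
  refine Finset.sum_congr rfl fun A _ => ?_
  rw [hred.leftDeriv_totalNoether_inl hγ hU hL hsym hY hu hYU hy hyV,
    hred.leftDeriv_totalNoether_inr hγ hU hL hsym hY hu hYU hy hyV,
    hred.leftDeriv_totalH_inl hγ hU hL hu hYU hy hyV,
    hred.leftDeriv_totalH_inr hγ hU hL hu hYU hy hyV, mul_smul_comm, neg_mul,
    mul_comm_of_mem_part (hsym.deltaP_mem_part hγ hU hL hx A)
      ((velAt U L f u y).2 (.inr A)).2]
  change sgn (par A * 0) • sgn (par A) • -(sgn (par A * par A) • _) - _ = _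
  rw [sgn_self_mul, smul_neg, sgn_smul_sgn_smul, mul_zero, zero_add, mul_one, smul_mul_assoc,
    sgn_smul_sgn_smul, mul_neg]
  simp only [sgn, if_true, one_smul]
  abel

end IsPrimaryReduction

end Charge

end SuperMech

theorem mainTheorem1 {𝕜 γ ι : Type*} [RCLike 𝕜] [LinearOrder γ] [Fintype ι] [DecidableEq ι]
    (par : ι → ZMod 2)
    -- enough Grassmann generators for left derivatives in fermionic directions to be unique
    (hγ : Infinite γ ∨ ∀ A, par A = 0)
    -- the Lagrangian, with its primary constraints
    (U : Set (VelPt 𝕜 γ par)) (hU : IsOpen U)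
    (L : VelPt 𝕜 γ par → Grassmann 𝕜 γ) (hL : IsSuperfunction 0 U L)
    (P R : Finset ι) (W : Set (HatPt 𝕜 γ par P R))
    (h : {A // A ∉ R} → HatPt 𝕜 γ par P R → Grassmann 𝕜 γ)
    (f : {A // A ∈ P} → RedPt 𝕜 γ par P → Grassmann 𝕜 γ)
    (hred : IsPrimaryReduction U L W h f)
    -- the symmetry of the Lagrangian
    (δq : ι → VelPt 𝕜 γ par → Grassmann 𝕜 γ) (δK : VelPt 𝕜 γ par → Grassmann 𝕜 γ)
    (hsym : IsLagrangianSymmetry U L δq δK)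
    -- the multipliers, on an open set of phase space where they correspond to velocities in `U`
    (Y : Set (PhasePt 𝕜 γ par)) (hY : IsOpen Y)
    (u : {A // A ∈ P} → PhasePt 𝕜 γ par → Grassmann 𝕜 γ)
    (hu : ∀ m : {A // A ∈ P}, IsSuperfunction (par m) Y (u m))
    (hYU : ∀ y ∈ Y, ∃ x ∈ U, LiesOver L x (toRed P y) ∧
      ∀ m : {A // A ∈ P}, (x.2 (.inr m.1) : Grassmann 𝕜 γ) = sgn (par m) • u m y) :
    -- the charge and the total Hamiltonian are differentiable
    (∀ y ∈ Y, (∃ D, IsLeftDiffAt (totalNoether U L f u δq δK) D y) ∧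
      ∃ D, IsLeftDiffAt (totalH U L f u) D y) ∧
    -- on the primary constraint surface
    (∀ y ∈ Y, (∀ m : {A // A ∈ P}, constraintFn f m y = 0) →
      -- conservation of the total Noether charge
      poisson 0 (totalNoether U L f u δq δK) (totalH U L f u) y
          + timeDeriv (totalNoether U L f u δq δK) y = 0 ∧
      -- the total Noether charge generates the symmetry transformations
      ∀ A : ι,
        poisson 0 (totalNoether U L f u δq δK) (fun z => (z.2 (.inl A) : Grassmann 𝕜 γ)) y
            = -δq A (velAt U L f u y) ∧
        poisson 0 (totalNoether U L f u δq δK) (fun z => (z.2 (.inr A) : Grassmann 𝕜 γ)) y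
            = -deltaP L δq δK A (velAt U L f u y)) ∧
    -- `deltaP` is the variation of the momentum up to the Euler-Lagrange equations
    (∀ x ∈ U, ∀ a : Vars 𝕜 γ par, ∀ A : ι,
      deltaP L δq δK A x = variation δq (momentum L A) x a
        - ∑ B, leftDeriv (δq B) (.inr A) x * eulerLagrange L B x a) := by
  have hs : EnoughGenerators γ par := hγ
  refine ⟨fun y hy => ⟨hred.sdiffAt_totalNoether hs hU hL hsym hY hu hYU hy,
    hred.sdiffAt_totalH hs hU hL hu hYU hy⟩, fun y hy hyV =>
    ⟨hred.poisson_totalNoether_totalH_add_timeDeriv hs hU hL hsym hY hu hYU hy hyV,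
      fun A => ⟨?_, ?_⟩⟩, fun x hx a A => hsym.deltaP_eq hs hU hL hx a A⟩
  · rw [poisson_coord_inl hs, hred.leftDeriv_totalNoether_inr hs hU hL hsym hY hu hYU hy hyV,
      sgn_smul_sgn_smul]
  · rw [poisson_coord_inr hs, hred.leftDeriv_totalNoether_inl hs hU hL hsym hY hu hYU hy hyV]
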